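/- Let $F$ be a non-archimedean local field of characteristic $2$ with residue field of cardinality $q$, and $E/F$ a totally ramified separable quadratic extension with non-trivial automorphism $\tau$ and discriminant $\mathfrak p_F^{d+1}$, $d>0$ odd. Let $\varpi,\pi$ be uniformizers of $F,E$ with $\pi^2+\Delta\pi+\varpi=0$, where $\Delta\in F$, $\mathrm{ord}_F(\Delta)=\frac{d+1}{2}$, and put $\varepsilon=\tau(\pi)/\pi$. Let $\iota\colon E\hookrightarrow \mathrm{Mat}_2(F)$ be the $F$-algebra embedding with $\pi\mapsto\begin{pmatrix}\Delta&1\\ \varpi&0\end{pmatrix}$. For $L=F,E$ let $I_L=\begin{pmatrix}\mathcal O_L^\times&\mathcal O_L\\ \mathfrak p_L&\mathcal O_L^\times\end{pmatrix}$, and write $e_-(a)=\begin{pmatrix}1&0\\a&1\end{pmatrix}$. Let $n\ge 1$ be an integer with $2n>d$, put $m=2n+d-1$, and set $$J=\begin{pmatrix}1+\mathfrak p_E^{m+1}&\mathfrak p_E^{m}\\ \mathfrak p_E^{m+1}&1+\mathfrak p_E^{m+1}\end{pmatrix},\quad \dot w=\begin{pmatrix}0&\pi^{-n}\\ \pi^n&0\end{pmatrix}\begin{pmatrix}\varepsilon^{\lfloor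 n/2\rfloor}&0\\0&\varepsilon^{-\lfloor (n+1)/2\rfloor}\end{pmatrix},\quad \dot v=\begin{pmatrix}0&\pi^{-(\frac{d+1}{2}+\lfloor \frac{n+1}{2}\rfloor)}\\ \pi^{\frac{d+1}{2}+\lfloor \frac n2\rfloor}&0\end{pmatrix}.$$ Let $X=\{gJ\in \mathrm{GL}_2(E)/J : g^{-1}\tau(g)\in J\dot wJ\}$ and let $X_{1/2}\subseteq X$ be the set of points of $X$ lying over the set of cosets $e_-(a)\dot vI_E\in \mathrm{GL}_2(E)/I_E$ with $\mathrm{ord}_E(a)=1$. Let $\widetilde\Gamma\subseteq E^\times I_E/J$ (with $E^\times$ the scalar matrices) be the stabilizer of $J\dot wJ$ under $i\colon y\mapsto i^{-1}y\tau(i)$; it acts on $X$ by right multiplication, and it contains the image of $E^\times$ under $t\mapsto i(t,0):=\mathrm{diag}(t,\tau(t))$. Let $\widetilde X$ be the union of all $\widetilde\Gamma$-translates of $X_{1/2}$; it is stable under left multiplication by $\iota(E^\times)I_F$. Let $\theta$ be a $\overline{\mathbb Q}_\ell^\times$-valued character of $E^\times$ of level $m$ (i.e. $m$ is the smallest integer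 $k\ge 0$ such that $\theta$ is trivial on $1+\mathfrak p_E^{k+1}$), and let $\tilde\theta$ be a $\overline{\mathbb Q}_\ell^\times$-valued character of $\widetilde\Gamma$ with $\tilde\theta(i(t,0))=\theta(t)$ for all $t\in E^\times$. Let $\Xi_{\tilde\theta}$ be the representation of $\iota(E^\times)I_F$ on the $\tilde\theta$-isotypic part (the largest quotient on which $\widetilde\Gamma$ acts by $\tilde\theta$) of the space $H^0_c(\widetilde X,\overline{\mathbb Q}_\ell)$ of finitely supported functions $\widetilde X\to\overline{\mathbb Q}_\ell$, on which $(g,t)\in \iota(E^\times)I_F\times\widetilde\Gamma$ acts by translation of functions along $xJ\mapsto gxt^{-1}J$. Then $\Xi_{\tilde\theta}$ is finite-dimensional, and for $g=e_-(u)\in I_F$ with $u\in\mathfrak p_F$ one has $$\mathrm{tr}(g;\Xi_{\tilde\theta})=\begin{cases}0&\text{if }\mathrm{ord}_F(u)<n+d,\\ -q^{n+d-1}&\text{if }\mathrm{ord}_F(u)=n+d,\\ (q-1)q^{n+d-1}&\text{if }\mathrm{ord}_F(u)\ge n+d+1\end{cases}$$ (with $\mathrm{ord}_F(0)=\infty$).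 -/

import Mathlib

namespace WildGL2

open ValuativeRel
open scoped MatrixGroups

section LocalField

variable (L : Type*) [Field L] [ValuativeRel L] [TopologicalSpace L]
  [IsNonarchimedeanLocalField L]

/-- The normalized additive valuation `ord_L` of a non-archimedean local field, with
`ord_L 0 = ⊤` and value `1` at uniformizers. -/
noncomputable def ord (x : L) : WithTop ℤ :=
  open Classical in
  if x = 0 then ⊤
  else ((-(WithZero.log (IsNonarchimedeanLocalField.valueGroupWithZeroIsoInt L
    (valuation L x))) : ℤ) : WithTop ℤ)

variable {L}

lemma ord_zero : ord L 0 = ⊤ := by simp [ord]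

lemma ord_eq_top {x : L} : ord L x = ⊤ ↔ x = 0 := by
  unfold ord
  split_ifs with h <;> simp [h]

lemma ord_one : ord L 1 = 0 := by simp [ord]

lemma ord_mul (x y : L) : ord L (x * y) = ord L x + ord L y := by
  by_cases hx : x = 0
  · simp [hx, ord_zero]
  by_cases hy : y = 0
  · simp [hy, ord_zero]
  have hx' : IsNonarchimedeanLocalField.valueGroupWithZeroIsoInt L (valuation L x) ≠ 0 := by
    simpa using hx
  have hy' : IsNonarchimedeanLocalField.valueGroupWithZeroIsoInt L (valuation L y) ≠ 0 := by
    simpa using hy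
  simp only [ord, hx, hy, mul_eq_zero, or_self, if_false, map_mul]
  rw [WithZero.log_mul hx' hy', neg_add]
  rfl

lemma ord_neg (x : L) : ord L (-x) = ord L x := by
  by_cases hx : x = 0 <;> simp [ord, hx, Valuation.map_neg]

lemma le_ord_iff {x : L} {j : ℤ} : ((j : ℤ) : WithTop ℤ) ≤ ord L x ↔
    IsNonarchimedeanLocalField.valueGroupWithZeroIsoInt L (valuation L x) ≤ WithZero.exp (-j) := by
  by_cases hx : x = 0
  · simp [hx, ord_zero]
  have hx' : IsNonarchimedeanLocalField.valueGroupWithZeroIsoInt L (valuation L x) ≠ 0 := by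
    simpa using hx
  simp only [ord, hx, if_false]
  rw [WithTop.coe_le_coe, ← WithZero.log_le_iff_le_exp hx']
  constructor <;> intro h <;> linarith

variable (L) in
/-- The fractional ideal `𝔭_L ^ j`, for `j : ℤ`. -/
def pPow (j : ℤ) : AddSubgroup L where
  carrier := {x | ((j : ℤ) : WithTop ℤ) ≤ ord L x}
  zero_mem' := by simp [ord_zero]
  neg_mem' := by
    intro x hx
    simpa [ord_neg] using hx
  add_mem' := by
    intro x y hx hy
    simp only [Set.mem_ofPred_eq, le_ord_iff] at hx hy ⊢
    rcases le_total (valuation L x) (valuation L y) with h | h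
    · refine le_trans ?_ hy
      exact (OrderIsoClass.toOrderHomClass.monotone _
        ((Valuation.map_add_le (valuation L) h le_rfl)))
    · refine le_trans ?_ hx
      exact (OrderIsoClass.toOrderHomClass.monotone _
        ((Valuation.map_add_le (valuation L) le_rfl h)))

lemma mem_pPow {j : ℤ} {x : L} : x ∈ pPow L j ↔ ((j : ℤ) : WithTop ℤ) ≤ ord L x := Iff.rfl

lemma pPow_mono {i j : ℤ} (h : i ≤ j) {x : L} (hx : x ∈ pPow L j) : x ∈ pPow L i :=
  le_trans (WithTop.coe_le_coe.2 h) hx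

lemma mul_mem_pPow {i j k : ℤ} {x y : L} (hx : x ∈ pPow L i) (hy : y ∈ pPow L j)
    (h : k ≤ i + j) : x * y ∈ pPow L k := by
  refine pPow_mono h ?_
  rw [mem_pPow, ord_mul, WithTop.coe_add]
  exact add_le_add hx hy

lemma mem_pPow_of_ord {j : ℤ} {x : L} (h : ord L x = (j : WithTop ℤ)) : x ∈ pPow L j :=
  h.ge

lemma ne_zero_of_ord {j : ℤ} {x : L} (h : ord L x = (j : WithTop ℤ)) : x ≠ 0 := by
  rintro rfl
  rw [ord_zero] at h
  exact WithTop.top_ne_coe h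

lemma exists_ord {x : L} (hx : x ≠ 0) : ∃ j : ℤ, ord L x = (j : WithTop ℤ) := by
  obtain ⟨j, hj⟩ := WithTop.ne_top_iff_exists.1 (mt ord_eq_top.1 hx)
  exact ⟨j, hj.symm⟩

lemma ord_mul_of {i j k : ℤ} {x y : L} (hx : ord L x = (i : WithTop ℤ))
    (hy : ord L y = (j : WithTop ℤ)) (h : i + j = k) : ord L (x * y) = (k : WithTop ℤ) := by
  rw [ord_mul, hx, hy, ← h, WithTop.coe_add]

lemma ord_inv_of {j k : ℤ} {x : L} (h : ord L x = (j : WithTop ℤ)) (hk : k = -j) :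
    ord L x⁻¹ = (k : WithTop ℤ) := by
  have hx := ne_zero_of_ord h
  obtain ⟨i, hi⟩ := exists_ord (inv_ne_zero hx)
  have := ord_mul_of h hi rfl
  rw [mul_inv_cancel₀ hx, ord_one, ← WithTop.coe_zero, WithTop.coe_eq_coe] at this
  rw [hi, WithTop.coe_eq_coe]
  omega

lemma ord_eq_iff {j : ℤ} {x : L} :
    ord L x = (j : WithTop ℤ) ↔ x ∈ pPow L j ∧ x ∉ pPow L (j + 1) := by
  by_cases hx : x = 0
  · simp [hx, ord_zero]
  obtain ⟨i, hi⟩ := exists_ord hx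
  simp only [mem_pPow, hi, WithTop.coe_eq_coe, WithTop.coe_le_coe]
  omega

lemma ord_add_of {j : ℤ} {x y : L} (hx : ord L x = (j : WithTop ℤ)) (hy : y ∈ pPow L (j + 1)) :
    ord L (x + y) = (j : WithTop ℤ) := by
  rw [ord_eq_iff] at hx ⊢
  refine ⟨add_mem hx.1 (pPow_mono (by omega) hy), fun h => hx.2 ?_⟩
  simpa using sub_mem h hy

/-- The lattice `[[𝔭^a, 𝔭^b], [𝔭^(b+1), 𝔭^a]]`, where `a = ⌊(k+1)/2⌋` and `b = ⌊k/2⌋`. -/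
def InLattice (k : ℕ) (M : Matrix (Fin 2) (Fin 2) L) : Prop :=
  M 0 0 ∈ pPow L ((k + 1) / 2 : ℕ) ∧ M 0 1 ∈ pPow L (k / 2 : ℕ) ∧
    M 1 0 ∈ pPow L ((k / 2 : ℕ) + 1) ∧ M 1 1 ∈ pPow L ((k + 1) / 2 : ℕ)

lemma InLattice.add {k : ℕ} {M N : Matrix (Fin 2) (Fin 2) L} (hM : InLattice k M)
    (hN : InLattice k N) : InLattice k (M + N) :=
  ⟨add_mem hM.1 hN.1, add_mem hM.2.1 hN.2.1, add_mem hM.2.2.1 hN.2.2.1,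
    add_mem hM.2.2.2 hN.2.2.2⟩

lemma InLattice.neg {k : ℕ} {M : Matrix (Fin 2) (Fin 2) L} (hM : InLattice k M) :
    InLattice k (-M) :=
  ⟨neg_mem hM.1, neg_mem hM.2.1, neg_mem hM.2.2.1, neg_mem hM.2.2.2⟩

lemma InLattice.zero_of {k : ℕ} {M : Matrix (Fin 2) (Fin 2) L} (hM : InLattice k M) :
    InLattice 0 M :=
  ⟨pPow_mono (by omega) hM.1, pPow_mono (by omega) hM.2.1, pPow_mono (by omega) hM.2.2.1,
    pPow_mono (by omega) hM.2.2.2⟩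

lemma InLattice.mul_left {k : ℕ} {M N : Matrix (Fin 2) (Fin 2) L} (hM : InLattice 0 M)
    (hN : InLattice k N) : InLattice k (M * N) := by
  obtain ⟨m1, m2, m3, m4⟩ := hM
  obtain ⟨n1, n2, n3, n4⟩ := hN
  refine ⟨?_, ?_, ?_, ?_⟩ <;> rw [Matrix.mul_apply, Fin.sum_univ_two]
  · exact add_mem (mul_mem_pPow m1 n1 (by omega)) (mul_mem_pPow m2 n3 (by omega))
  · exact add_mem (mul_mem_pPow m1 n2 (by omega)) (mul_mem_pPow m2 n4 (by omega))
  · exact add_mem (mul_mem_pPow m3 n1 (by omega)) (mul_mem_pPow m4 n3 (by omega))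
  · exact add_mem (mul_mem_pPow m3 n2 (by omega)) (mul_mem_pPow m4 n4 (by omega))

lemma InLattice.mul_right {k : ℕ} {M N : Matrix (Fin 2) (Fin 2) L} (hM : InLattice k M)
    (hN : InLattice 0 N) : InLattice k (M * N) := by
  obtain ⟨m1, m2, m3, m4⟩ := hM
  obtain ⟨n1, n2, n3, n4⟩ := hN
  refine ⟨?_, ?_, ?_, ?_⟩ <;> rw [Matrix.mul_apply, Fin.sum_univ_two]
  · exact add_mem (mul_mem_pPow m1 n1 (by omega)) (mul_mem_pPow m2 n3 (by omega))
  · exact add_mem (mul_mem_pPow m1 n2 (by omega)) (mul_mem_pPow m2 n4 (by omega))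
  · exact add_mem (mul_mem_pPow m3 n1 (by omega)) (mul_mem_pPow m4 n3 (by omega))
  · exact add_mem (mul_mem_pPow m3 n2 (by omega)) (mul_mem_pPow m4 n4 (by omega))

lemma inLattice_one : InLattice 0 (1 : Matrix (Fin 2) (Fin 2) L) := by
  have h1 : (1 : L) ∈ pPow L 0 := mem_pPow_of_ord (by rw [ord_one]; rfl)
  refine ⟨?_, ?_, ?_, ?_⟩ <;> simp [h1, zero_mem]

variable (L) in
/-- The Iwahori subgroup `I_L = [[O^×, O], [𝔭, O^×]]` of `GL_2(L)`. -/
def iwahori : Subgroup (GL (Fin 2) L) where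
  carrier := {g | ord L (g 0 0) = (0 : ℤ) ∧ g 0 1 ∈ pPow L 0 ∧ g 1 0 ∈ pPow L 1 ∧
    ord L (g 1 1) = (0 : ℤ)}
  one_mem' := by
    refine ⟨?_, ?_, ?_, ?_⟩ <;> simp [ord_one, zero_mem]
  mul_mem' := by
    rintro g h ⟨g1, g2, g3, g4⟩ ⟨h1, h2, h3, h4⟩
    have mg1 := mem_pPow_of_ord g1
    have mg4 := mem_pPow_of_ord g4
    have mh1 := mem_pPow_of_ord h1
    have mh4 := mem_pPow_of_ord h4
    refine ⟨?_, ?_, ?_, ?_⟩ <;> rw [Units.val_mul, Matrix.mul_apply, Fin.sum_univ_two]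
    · exact ord_add_of (ord_mul_of g1 h1 (by omega)) (mul_mem_pPow g2 h3 (by omega))
    · exact add_mem (mul_mem_pPow mg1 h2 (by omega)) (mul_mem_pPow g2 mh4 (by omega))
    · exact add_mem (mul_mem_pPow g3 mh1 (by omega)) (mul_mem_pPow mg4 h3 (by omega))
    · rw [add_comm]
      exact ord_add_of (ord_mul_of g4 h4 (by omega)) (mul_mem_pPow g3 h2 (by omega))
  inv_mem' := by
    rintro g ⟨g1, g2, g3, g4⟩
    have mg1 := mem_pPow_of_ord g1
    have mg4 := mem_pPow_of_ord g4
    have hd : ord L (g : Matrix (Fin 2) (Fin 2) L).det = (0 : ℤ) := by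
      rw [Matrix.det_fin_two, sub_eq_add_neg]
      exact ord_add_of (ord_mul_of g1 g4 (by omega)) (neg_mem (mul_mem_pPow g2 g3 (by omega)))
    have hi := ord_inv_of hd (k := 0) (by omega)
    have mi := mem_pPow_of_ord hi
    have hinv : ((g⁻¹ : GL (Fin 2) L) : Matrix (Fin 2) (Fin 2) L) =
        (g : Matrix (Fin 2) (Fin 2) L).det⁻¹ • !![g 1 1, -g 0 1; -g 1 0, g 0 0] := by
      rw [Matrix.coe_units_inv, Matrix.inv_def, Matrix.adjugate_fin_two, Ring.inverse_eq_inv']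
    refine ⟨?_, ?_, ?_, ?_⟩ <;> rw [hinv] <;> simp only [Matrix.smul_apply, smul_eq_mul] <;> simp
    · exact ord_mul_of hi g4 (by omega)
    · exact mul_mem_pPow mi g2 (by omega)
    · exact mul_mem_pPow mi g3 (by omega)
    · exact ord_mul_of hi g1 (by omega)

lemma inLattice_of_mem_iwahori {g : GL (Fin 2) L} (hg : g ∈ iwahori L) :
    InLattice 0 (g : Matrix (Fin 2) (Fin 2) L) :=
  ⟨mem_pPow_of_ord hg.1, hg.2.1, hg.2.2.1, mem_pPow_of_ord hg.2.2.2⟩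

variable (L) in
/-- The level subgroups
`I_L^k = [[1 + 𝔭^⌊(k+1)/2⌋, 𝔭^⌊k/2⌋], [𝔭^(⌊k/2⌋+1), 1 + 𝔭^⌊(k+1)/2⌋]]` of `I_L`. -/
def levelSubgroup (k : ℕ) : Subgroup (GL (Fin 2) L) where
  carrier := {g | g ∈ iwahori L ∧ InLattice k ((g : Matrix (Fin 2) (Fin 2) L) - 1)}
  one_mem' := by
    refine ⟨one_mem _, ?_, ?_, ?_, ?_⟩ <;> simp [zero_mem]
  mul_mem' := by
    rintro g h ⟨hg, hg'⟩ ⟨hh, hh'⟩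
    refine ⟨mul_mem hg hh, ?_⟩
    have : ((g * h : GL (Fin 2) L) : Matrix (Fin 2) (Fin 2) L) - 1 =
        ((g : Matrix (Fin 2) (Fin 2) L) - 1) * h + ((h : Matrix (Fin 2) (Fin 2) L) - 1) := by
      rw [Units.val_mul]
      noncomm_ring
    rw [this]
    exact (hg'.mul_right (inLattice_of_mem_iwahori hh)).add hh'
  inv_mem' := by
    rintro g ⟨hg, hg'⟩
    refine ⟨inv_mem hg, ?_⟩
    have : ((g⁻¹ : GL (Fin 2) L) : Matrix (Fin 2) (Fin 2) L) - 1 =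
        -(((g⁻¹ : GL (Fin 2) L) : Matrix (Fin 2) (Fin 2) L) *
          ((g : Matrix (Fin 2) (Fin 2) L) - 1)) := by
      rw [mul_sub, Units.inv_mul]
      noncomm_ring
    rw [this]
    exact (InLattice.mul_left (inLattice_of_mem_iwahori (inv_mem hg)) hg').neg

lemma levelSubgroup_le (k : ℕ) : levelSubgroup L k ≤ iwahori L := fun _ hg => hg.1

lemma conj_mem_levelSubgroup {k : ℕ} {i g : GL (Fin 2) L} (hi : i ∈ iwahori L)
    (hg : g ∈ levelSubgroup L k) : i * g * i⁻¹ ∈ levelSubgroup L k := by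
  refine ⟨mul_mem (mul_mem hi hg.1) (inv_mem hi), ?_⟩
  have : ((i * g * i⁻¹ : GL (Fin 2) L) : Matrix (Fin 2) (Fin 2) L) - 1 =
      (i : Matrix (Fin 2) (Fin 2) L) * ((g : Matrix (Fin 2) (Fin 2) L) - 1) *
        ((i⁻¹ : GL (Fin 2) L) : Matrix (Fin 2) (Fin 2) L) := by
    rw [mul_sub, sub_mul, mul_one, Units.mul_inv, Units.val_mul, Units.val_mul]
  rw [this]
  exact (InLattice.mul_left (inLattice_of_mem_iwahori hi) hg.2).mul_right
    (inLattice_of_mem_iwahori (inv_mem hi))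

variable (L) in
/-- The group `Z(L) I_L`, where `Z` is the center of `GL_2`. -/
def centerIwahori : Subgroup (GL (Fin 2) L) := Subgroup.center (GL (Fin 2) L) ⊔ iwahori L

lemma centerIwahori_le_normalizer (k : ℕ) :
    centerIwahori L ≤ Subgroup.normalizer (levelSubgroup L k : Set (GL (Fin 2) L)) := by
  refine sup_le (Subgroup.center_le_normalizer _) fun i hi => ?_
  rw [Subgroup.mem_normalizer_iff]
  refine fun g => ⟨conj_mem_levelSubgroup hi, fun h => ?_⟩
  simpa [mul_assoc] using conj_mem_levelSubgroup (inv_mem hi) h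

/-- The lower unipotent matrix `e_-(a)`. -/
def eMinus {R : Type*} [CommRing R] (a : R) : GL (Fin 2) R where
  val := !![1, 0; a, 1]
  inv := !![1, 0; -a, 1]
  val_inv := by simp [Matrix.one_fin_two]
  inv_val := by simp [Matrix.one_fin_two]

/-- The diagonal matrix `e_0(x, y)`. -/
def diag {R : Type*} [CommRing R] (x y : Rˣ) : GL (Fin 2) R where
  val := !![(x : R), 0; 0, (y : R)]
  inv := !![((x⁻¹ : Rˣ) : R), 0; 0, ((y⁻¹ : Rˣ) : R)]
  val_inv := by simp [Matrix.one_fin_two]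
  inv_val := by simp [Matrix.one_fin_two]

/-- The antidiagonal matrix `[[0, x], [y, 0]]`. -/
def antidiag {R : Type*} [CommRing R] (x y : Rˣ) : GL (Fin 2) R where
  val := !![0, (x : R); (y : R), 0]
  inv := !![0, ((y⁻¹ : Rˣ) : R); ((x⁻¹ : Rˣ) : R), 0]
  val_inv := by simp [Matrix.one_fin_two]
  inv_val := by simp [Matrix.one_fin_two]

lemma eMinus_mem_iwahori {u : L} (hu : 1 ≤ ord L u) : eMinus u ∈ iwahori L := by
  refine ⟨?_, ?_, ?_, ?_⟩ <;> simp [eMinus, ord_one, zero_mem]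
  exact hu

end LocalField

section Data

variable (F E : Type*) [Field F] [ValuativeRel F] [TopologicalSpace F]
  [IsNonarchimedeanLocalField F] [Field E] [ValuativeRel E] [TopologicalSpace E]
  [IsNonarchimedeanLocalField E] [Algebra F E]

/-- The discriminant ideal of a quadratic extension `E/F` of local fields: the ideal of `O_F`
generated by the discriminants of all pairs of elements of `O_E`. -/
noncomputable def discriminantIdeal : Ideal 𝒪[F] :=
  Ideal.span {δ | ∃ x y : E, 0 ≤ ord E x ∧ 0 ≤ ord E y ∧
    (δ : F) = Algebra.discr F ![x, y]}

/-- A totally ramified quadratic extension `E/F` of local fields with non-trivial automorphism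
`τ` and discriminant `𝔭_F^(d+1)`, `d > 0` odd, together with the choice of uniformizers `π` of `E`
and `ϖ` of `F` such that `π² + Δ π + ϖ = 0` with `Δ ∈ F` of valuation `(d+1)/2`. -/
structure WildQuadraticData (d : ℕ) where
  d_pos : 0 < d
  d_odd : Odd d
  finrank_eq : Module.finrank F E = 2
  /-- `E/F` is an extension of local fields of ramification index `2`. -/
  ord_algebraMap : ∀ x : F, ord E (algebraMap F E x) = ord F x + ord F x
  /-- The non-trivial element of the Galois group. -/
  τ : E ≃ₐ[F] E
  τ_ne : τ ≠ 1
  discr_eq : discriminantIdeal F E = 𝓂[F] ^ (d + 1)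
  /-- The uniformizer of `F`. -/
  ϖ : F
  /-- The uniformizer of `E`. -/
  π : E
  /-- The trace of `π`. -/
  Δ : F
  ord_ϖ : ord F ϖ = 1
  ord_π : ord E π = 1
  ord_Δ : ord F Δ = (((d + 1) / 2 : ℕ) : ℤ)
  minpoly_π : π ^ 2 + algebraMap F E Δ * π + algebraMap F E ϖ = 0

end Data

namespace WildQuadraticData

variable {F E : Type*} [Field F] [ValuativeRel F] [TopologicalSpace F]
  [IsNonarchimedeanLocalField F] [Field E] [ValuativeRel E] [TopologicalSpace E]
  [IsNonarchimedeanLocalField E] [Algebra F E] {d : ℕ}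

lemma ord_algebraMap_of (D : WildQuadraticData F E d) {x : F} {j k : ℤ}
    (h : ord F x = (j : WithTop ℤ)) (hk : j + j = k) :
    ord E (algebraMap F E x) = (k : WithTop ℤ) := by
  rw [D.ord_algebraMap, h, ← hk, WithTop.coe_add]

lemma algebraMap_mem_pPow (D : WildQuadraticData F E d) {x : F} {j k : ℤ}
    (h : x ∈ pPow F j) (hk : k ≤ j + j) : algebraMap F E x ∈ pPow E k := by
  refine pPow_mono hk ?_
  rw [mem_pPow, D.ord_algebraMap, WithTop.coe_add]
  exact add_le_add h h

lemma ord_π' (D : WildQuadraticData F E d) : ord E D.π = ((1 : ℤ) : WithTop ℤ) := D.ord_π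

lemma π_ne_zero (D : WildQuadraticData F E d) : D.π ≠ 0 := ne_zero_of_ord D.ord_π'

lemma ord_ϖ' (D : WildQuadraticData F E d) :
    ord E (algebraMap F E D.ϖ) = ((2 : ℤ) : WithTop ℤ) :=
  D.ord_algebraMap_of (j := 1) D.ord_ϖ (by norm_num)

lemma ord_Δ' (D : WildQuadraticData F E d) :
    ord E (algebraMap F E D.Δ) = ((d + 1 : ℤ) : WithTop ℤ) := by
  refine D.ord_algebraMap_of D.ord_Δ ?_
  have := D.d_odd
  obtain ⟨k, rfl⟩ := this
  omega

/-- An element `a + b π` has valuation at least `j` only if both summands do. -/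
lemma coords_mem (D : WildQuadraticData F E d) {a b : F} {j : ℤ}
    (h : algebraMap F E a + algebraMap F E b * D.π ∈ pPow E j) :
    algebraMap F E a ∈ pPow E j ∧ algebraMap F E b * D.π ∈ pPow E j := by
  by_cases ha : a = 0
  · subst ha
    simpa [zero_mem] using h
  by_cases hb : b = 0
  · subst hb
    simpa [zero_mem] using h
  obtain ⟨i, hi⟩ := exists_ord ha
  obtain ⟨k, hk⟩ := exists_ord hb
  have hi' := D.ord_algebraMap_of hi rfl
  have hk' := ord_mul_of (D.ord_algebraMap_of hk rfl) D.ord_π' rfl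
  rcases lt_trichotomy (i + i) (k + k + 1) with hlt | heq | hlt
  · have := ord_add_of hi' (pPow_mono (Int.add_one_le_of_lt hlt) (mem_pPow_of_ord hk'))
    rw [mem_pPow, this, WithTop.coe_le_coe] at h
    exact ⟨pPow_mono h (mem_pPow_of_ord hi'), pPow_mono (by omega) (mem_pPow_of_ord hk')⟩
  · omega
  · have := ord_add_of hk' (pPow_mono (Int.add_one_le_of_lt hlt) (mem_pPow_of_ord hi'))
    rw [add_comm, mem_pPow, this, WithTop.coe_le_coe] at h
    exact ⟨pPow_mono (by omega) (mem_pPow_of_ord hi'), pPow_mono h (mem_pPow_of_ord hk')⟩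

lemma linearIndependent_π_one (D : WildQuadraticData F E d) :
    LinearIndependent F ![D.π, (1 : E)] := by
  rw [LinearIndependent.pair_iff]
  intro s t h
  have h0 : algebraMap F E t + algebraMap F E s * D.π = 0 := by
    rw [← h, Algebra.smul_def, Algebra.smul_def, mul_one, add_comm]
  have key : ∀ j : ℤ, algebraMap F E t ∈ pPow E j ∧ algebraMap F E s * D.π ∈ pPow E j :=
    fun j => D.coords_mem (by rw [h0]; exact zero_mem _)
  have aux : ∀ x : E, (∀ j : ℤ, x ∈ pPow E j) → x = 0 := by
    intro x hx
    by_contra hne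
    obtain ⟨i, hi⟩ := exists_ord hne
    exact (ord_eq_iff.1 hi).2 (hx _)
  have ht := aux _ fun j => (key j).1
  have hs := aux _ fun j => (key j).2
  simp only [mul_eq_zero, D.π_ne_zero, or_false] at hs
  exact ⟨by simpa using hs, by simpa using ht⟩

/-- The `F`-basis `(π, 1)` of `E`. -/
noncomputable def basis (D : WildQuadraticData F E d) : Module.Basis (Fin 2) F E :=
  basisOfLinearIndependentOfCardEqFinrank D.linearIndependent_π_one (by simp [D.finrank_eq])

lemma exists_coords (D : WildQuadraticData F E d) (x : E) :
    ∃ a b : F, x = algebraMap F E a + algebraMap F E b * D.π := by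
  refine ⟨D.basis.repr x 1, D.basis.repr x 0, ?_⟩
  conv_lhs => rw [← D.basis.sum_repr x]
  simp [basis, Fin.sum_univ_two, Algebra.smul_def, add_comm]

/-- The embedding `ι : E → Mat_2(F)` of `F`-algebras, given by the multiplication of `E` on
itself in the basis `(π, 1)`. -/
noncomputable def ι (D : WildQuadraticData F E d) : E →ₐ[F] Matrix (Fin 2) (Fin 2) F :=
  Algebra.leftMulMatrix D.basis

/-- In characteristic two, `ι` is the embedding with `π ↦ [[Δ, 1], [ϖ, 0]]`. -/
lemma ι_π [CharP F 2] (D : WildQuadraticData F E d) : D.ι D.π = !![D.Δ, 1; D.ϖ, 0] := by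
  have : CharP E 2 := charP_of_injective_algebraMap (algebraMap F E).injective 2
  have b0 : D.basis 0 = D.π := by simp [basis]
  have b1 : D.basis 1 = 1 := by simp [basis]
  have h1 : D.π * D.basis 0 = D.Δ • D.basis 0 + D.ϖ • D.basis 1 := by
    rw [b0, b1, Algebra.smul_def, Algebra.smul_def, mul_one, ← sub_eq_zero, CharTwo.sub_eq_add]
    linear_combination D.minpoly_π
  have h2 : D.π * D.basis 1 = D.basis 0 := by rw [b0, b1, mul_one]
  ext i j
  rw [ι, Algebra.leftMulMatrix_eq_repr_mul]
  fin_cases j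
  · simp only [Fin.zero_eta, Fin.isValue, h1]
    fin_cases i <;> simp
  · simp only [Fin.mk_one, Fin.isValue, h2]
    fin_cases i <;> simp

lemma ι_coords [CharP F 2] (D : WildQuadraticData F E d) (a b : F) :
    D.ι (algebraMap F E a + algebraMap F E b * D.π) = !![a + b * D.Δ, b; b * D.ϖ, a] := by
  rw [map_add, map_mul, AlgHom.commutes, AlgHom.commutes, D.ι_π]
  ext i j
  fin_cases i <;> fin_cases j <;> simp [Matrix.algebraMap_matrix_apply, Matrix.mul_apply]

lemma τ_π [CharP F 2] (D : WildQuadraticData F E d) : D.τ D.π = algebraMap F E D.Δ + D.π := by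
  have : CharP E 2 := charP_of_injective_algebraMap (algebraMap F E).injective 2
  have h1 := D.minpoly_π
  have h2 := congrArg D.τ D.minpoly_π
  simp only [map_add, map_mul, map_pow, AlgEquiv.commutes, map_zero] at h2
  have h3 : (D.τ D.π - D.π) * (D.τ D.π - (-D.π - algebraMap F E D.Δ)) = 0 := by
    linear_combination h2 - h1
  rcases mul_eq_zero.1 h3 with h | h
  · exfalso
    apply D.τ_ne
    ext x
    obtain ⟨a, b, rfl⟩ := D.exists_coords x
    simp [sub_eq_zero.1 h]
  · rw [sub_eq_zero.1 h, CharTwo.neg_eq, CharTwo.sub_eq_add, add_comm]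

lemma τ_τ [CharP F 2] (D : WildQuadraticData F E d) (x : E) : D.τ (D.τ x) = x := by
  have : CharP E 2 := charP_of_injective_algebraMap (algebraMap F E).injective 2
  have h : D.τ (D.τ D.π) = D.π := by
    rw [D.τ_π, map_add, AlgEquiv.commutes, D.τ_π, ← add_assoc, CharTwo.add_self_eq_zero, zero_add]
  obtain ⟨a, b, rfl⟩ := D.exists_coords x
  simp [h]

lemma ord_τ_π [CharP F 2] (D : WildQuadraticData F E d) :
    ord E (D.τ D.π) = ((1 : ℤ) : WithTop ℤ) := by
  have := D.d_pos
  rw [D.τ_π, add_comm]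
  exact ord_add_of D.ord_π' (pPow_mono (by omega) (mem_pPow_of_ord D.ord_Δ'))

lemma τ_mem_pPow [CharP F 2] (D : WildQuadraticData F E d) {x : E} {j : ℤ} (hx : x ∈ pPow E j) :
    D.τ x ∈ pPow E j := by
  obtain ⟨a, b, rfl⟩ := D.exists_coords x
  obtain ⟨ha, hb⟩ := D.coords_mem hx
  rw [map_add, map_mul, AlgEquiv.commutes, AlgEquiv.commutes]
  refine add_mem ha ?_
  rw [mem_pPow, ord_mul, D.ord_τ_π, ← D.ord_π', ← ord_mul]
  exact hb

lemma ord_τ [CharP F 2] (D : WildQuadraticData F E d) {x : E} {j : ℤ}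
    (hx : ord E x = (j : WithTop ℤ)) : ord E (D.τ x) = (j : WithTop ℤ) := by
  rw [ord_eq_iff] at hx ⊢
  refine ⟨D.τ_mem_pPow hx.1, fun h => hx.2 ?_⟩
  simpa [D.τ_τ] using D.τ_mem_pPow h

/-- `π` as a unit of `E`. -/
noncomputable def πU (D : WildQuadraticData F E d) : Eˣ := Units.mk0 D.π D.π_ne_zero

/-- `τ` on `E^×`. -/
def τU (D : WildQuadraticData F E d) : Eˣ →* Eˣ := Units.map (D.τ : E →* E)

/-- `ε = τ(π) / π`. -/
noncomputable def ε (D : WildQuadraticData F E d) : Eˣ := D.τU D.πU * D.πU⁻¹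

/-- `τ` on `GL_2(E)`. -/
def τG (D : WildQuadraticData F E d) : GL (Fin 2) E →* GL (Fin 2) E :=
  Matrix.GeneralLinearGroup.map (D.τ : E →+* E)

/-- The inclusion `GL_2(F) → GL_2(E)`. -/
def incl (_ : WildQuadraticData F E d) : GL (Fin 2) F →* GL (Fin 2) E :=
  Matrix.GeneralLinearGroup.map (algebraMap F E)

/-- The embedding `ι : E^× → GL_2(F)`. -/
noncomputable def ιU (D : WildQuadraticData F E d) : Eˣ →* GL (Fin 2) F :=
  Units.map (D.ι : E →* Matrix (Fin 2) (Fin 2) F)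

/-- The subgroup `ι(E^×) I_F` of `GL_2(F)`. -/
noncomputable def torusIwahori (D : WildQuadraticData F E d) : Subgroup (GL (Fin 2) F) :=
  D.ιU.range ⊔ iwahori F

/-- The element `ẇ = [[0, π^(-n)], [π^n, 0]] · e_0(ε^⌊n/2⌋, ε^(-⌊(n+1)/2⌋))`. -/
noncomputable def wDot (D : WildQuadraticData F E d) (n : ℕ) : GL (Fin 2) E :=
  antidiag (D.πU ^ n)⁻¹ (D.πU ^ n) * diag (D.ε ^ (n / 2)) (D.ε ^ ((n + 1) / 2))⁻¹

/-- The element `v̇`, antidiagonal with entries `π^(-(⌊(d+1)/2⌋ + ⌊(n+1)/2⌋))` and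
`π^(⌊(d+1)/2⌋ + ⌊n/2⌋)`. -/
noncomputable def vDot (D : WildQuadraticData F E d) (n : ℕ) : GL (Fin 2) E :=
  antidiag (D.πU ^ ((d + 1) / 2 + (n + 1) / 2))⁻¹ (D.πU ^ ((d + 1) / 2 + n / 2))

end WildQuadraticData

section Varieties

variable {F E : Type*} [Field F] [ValuativeRel F] [TopologicalSpace F]
  [IsNonarchimedeanLocalField F] [Field E] [ValuativeRel E] [TopologicalSpace E]
  [IsNonarchimedeanLocalField E] [Algebra F E] {d : ℕ}

/-- The extended affine Deligne-Lusztig variety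
`X_w^J(b) = {gJ ∈ GL_2(E)/J : g⁻¹ b τ(g) ∈ J w J}`. -/
def eadlv (D : WildQuadraticData F E d) (J : Subgroup (GL (Fin 2) E)) (w b : GL (Fin 2) E) :
    Set (GL (Fin 2) E ⧸ J) :=
  {c | ∃ g : GL (Fin 2) E, (g : GL (Fin 2) E ⧸ J) = c ∧
    g⁻¹ * b * D.τG g ∈ DoubleCoset.doubleCoset w (J : Set (GL (Fin 2) E)) J}

/-- The preimage in `GL_2(E)` of the part `C_v(a_1 ≠ 0)` of the Schubert cell
`C_v = I_E v̇ I_E / I_E = {e_-(a) v̇ I_E : a ∈ 𝔭_E}`, consisting of the `e_-(a) v̇ I_E` with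
`a ∈ 𝔭_E`, `a ∉ 𝔭_E²`. -/
def cell (D : WildQuadraticData F E d) (n : ℕ) : Set (GL (Fin 2) E) :=
  {x | ∃ a : E, ord E a = 1 ∧ ∃ i ∈ iwahori E, x = eMinus a * D.vDot n * i}

/-- The finite piece `X_ẇ^m(1)_{P_{1/2}}` of the variety `X_ẇ^m(1)` of level `I_E^(2m+1)`: the
points lying over `C_v(a_1 ≠ 0)`. -/
def xHalf (D : WildQuadraticData F E d) (n m : ℕ) :
    Set (GL (Fin 2) E ⧸ levelSubgroup E (2 * m + 1)) :=
  {c | c ∈ eadlv D (levelSubgroup E (2 * m + 1)) (D.wDot n) 1 ∧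
    ∃ x ∈ cell D n, (x : GL (Fin 2) E ⧸ levelSubgroup E (2 * m + 1)) = c}

/-- The preimage in `Z(E) I_E` of the group `Γ̃`: the stabilizer of the double coset `J ẇ J`,
`J = I_E^(2m+1)`, under the action `(i, y) ↦ i⁻¹ y τ(i)`. -/
def rawGamma (D : WildQuadraticData F E d) (n m : ℕ) : Subgroup (GL (Fin 2) E) where
  carrier := {i | i ∈ centerIwahori E ∧ ∀ y : GL (Fin 2) E,
    i⁻¹ * y * D.τG i ∈ DoubleCoset.doubleCoset (D.wDot n)
      (levelSubgroup E (2 * m + 1) : Set (GL (Fin 2) E)) (levelSubgroup E (2 * m + 1)) ↔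
    y ∈ DoubleCoset.doubleCoset (D.wDot n)
      (levelSubgroup E (2 * m + 1) : Set (GL (Fin 2) E)) (levelSubgroup E (2 * m + 1))}
  one_mem' := ⟨one_mem _, fun y => by simp⟩
  mul_mem' := by
    rintro i j ⟨hi, hi'⟩ ⟨hj, hj'⟩
    refine ⟨mul_mem hi hj, fun y => ?_⟩
    refine Iff.trans (Eq.to_iff ?_) ((hj' (i⁻¹ * y * D.τG i)).trans (hi' y))
    rw [map_mul, mul_inv_rev]
    simp only [mul_assoc]
  inv_mem' := by
    rintro i ⟨hi, hi'⟩
    refine ⟨inv_mem hi, fun y => ?_⟩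
    refine Iff.trans (hi' _).symm (Eq.to_iff ?_)
    congr 1
    simp [mul_assoc]

lemma rawGamma_le_normalizer (D : WildQuadraticData F E d) (n m : ℕ) :
    rawGamma D n m ≤
      Subgroup.normalizer (levelSubgroup E (2 * m + 1) : Set (GL (Fin 2) E)) :=
  fun _ hi => centerIwahori_le_normalizer _ hi.1

instance normal_in_rawGamma (D : WildQuadraticData F E d) (n m : ℕ) :
    ((levelSubgroup E (2 * m + 1)).subgroupOf (rawGamma D n m)).Normal :=
  Subgroup.normal_subgroupOf_of_le_normalizer (rawGamma_le_normalizer D n m)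

/-- The group `Γ̃ ⊆ Z(E) I_E / I_E^(2m+1)`. -/
def GammaTilde (D : WildQuadraticData F E d) (n m : ℕ) : Type _ :=
  rawGamma D n m ⧸ (levelSubgroup E (2 * m + 1)).subgroupOf (rawGamma D n m)

instance (D : WildQuadraticData F E d) (n m : ℕ) : Group (GammaTilde D n m) :=
  inferInstanceAs
    (Group (rawGamma D n m ⧸ (levelSubgroup E (2 * m + 1)).subgroupOf (rawGamma D n m)))

/-- The projection onto `Γ̃` of its preimage. -/
def toGammaTilde (D : WildQuadraticData F E d) (n m : ℕ) : rawGamma D n m →* GammaTilde D n m :=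
  QuotientGroup.mk' _

lemma toGammaTilde_surjective (D : WildQuadraticData F E d) (n m : ℕ) :
    Function.Surjective (toGammaTilde D n m) :=
  QuotientGroup.mk'_surjective _

/-- Right multiplication by an element normalizing `J` on `G/J`. -/
def mulRight {G : Type*} [Group G] {J : Subgroup G} (γ : G)
    (h : γ ∈ Subgroup.normalizer (J : Set G)) : G ⧸ J → G ⧸ J :=
  Quotient.map' (fun x => x * γ) fun x y hxy => by
    rw [QuotientGroup.leftRel_apply] at hxy ⊢
    have := (Subgroup.mem_normalizer_iff.1 (inv_mem h) (x⁻¹ * y)).1 hxy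
    simpa [mul_assoc] using this

/-- The action of the preimage of `Γ̃` on `GL_2(E)/I_E^(2m+1)` by `(γ, xJ) ↦ x γ⁻¹ J`. -/
def rawGammaAction (D : WildQuadraticData F E d) (n m : ℕ) :
    rawGamma D n m →* Equiv.Perm (GL (Fin 2) E ⧸ levelSubgroup E (2 * m + 1)) where
  toFun γ :=
    { toFun := mulRight (γ : GL (Fin 2) E)⁻¹ (rawGamma_le_normalizer D n m (inv_mem γ.2))
      invFun := mulRight (γ : GL (Fin 2) E) (rawGamma_le_normalizer D n m γ.2)
      left_inv := by
        intro c
        induction c using QuotientGroup.induction_on with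
        | H x => exact congrArg _ (inv_mul_cancel_right x _)
      right_inv := by
        intro c
        induction c using QuotientGroup.induction_on with
        | H x => exact congrArg _ (mul_inv_cancel_right x _) }
  map_one' := by
    ext c
    induction c using QuotientGroup.induction_on with
    | H x =>
      change QuotientGroup.mk (x * (1 : GL (Fin 2) E)⁻¹) = QuotientGroup.mk x
      simp
  map_mul' γ δ := by
    ext c
    induction c using QuotientGroup.induction_on with
    | H x =>
      change QuotientGroup.mk (x * (γ.1 * δ.1)⁻¹) = QuotientGroup.mk (x * δ.1⁻¹ * γ.1⁻¹)
      rw [mul_inv_rev, mul_assoc]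

/-- The action of `Γ̃` on `GL_2(E)/I_E^(2m+1)` by `(γ, xJ) ↦ x γ⁻¹ J`. -/
def gammaAction (D : WildQuadraticData F E d) (n m : ℕ) :
    GammaTilde D n m →* Equiv.Perm (GL (Fin 2) E ⧸ levelSubgroup E (2 * m + 1)) :=
  QuotientGroup.lift _ (rawGammaAction D n m) fun γ hγ => by
    ext c
    induction c using QuotientGroup.induction_on with
    | H x =>
      change QuotientGroup.mk (x * γ.1⁻¹) = QuotientGroup.mk x
      rw [QuotientGroup.eq]
      simpa [Subgroup.mem_subgroupOf] using hγ

lemma gammaAction_mk (D : WildQuadraticData F E d) (n m : ℕ) (γ : rawGamma D n m)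
    (x : GL (Fin 2) E) :
    gammaAction D n m (toGammaTilde D n m γ)
      (x : GL (Fin 2) E ⧸ levelSubgroup E (2 * m + 1)) = QuotientGroup.mk (x * γ.1⁻¹) :=
  rfl

/-- The union `X̃_ẇ^m(1)_{P_{1/2}}` of all `Γ̃`-translates of `X_ẇ^m(1)_{P_{1/2}}`. -/
def XTilde (D : WildQuadraticData F E d) (n m : ℕ) :
    Set (GL (Fin 2) E ⧸ levelSubgroup E (2 * m + 1)) :=
  {c | ∃ γ : GammaTilde D n m, ∃ c₀ ∈ xHalf D n m, gammaAction D n m γ c₀ = c}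

lemma gammaAction_mem (D : WildQuadraticData F E d) (n m : ℕ) (γ : GammaTilde D n m)
    {c : GL (Fin 2) E ⧸ levelSubgroup E (2 * m + 1)} (hc : c ∈ XTilde D n m) :
    gammaAction D n m γ c ∈ XTilde D n m := by
  obtain ⟨δ, c₀, h, rfl⟩ := hc
  exact ⟨γ * δ, c₀, h, by rw [map_mul]; rfl⟩

lemma gammaAction_smul (D : WildQuadraticData F E d) (n m : ℕ) (γ : GammaTilde D n m)
    (g : GL (Fin 2) E) (c : GL (Fin 2) E ⧸ levelSubgroup E (2 * m + 1)) :
    gammaAction D n m γ (g • c) = g • gammaAction D n m γ c := by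
  obtain ⟨γ, rfl⟩ := toGammaTilde_surjective D n m γ
  induction c using QuotientGroup.induction_on with
  | H x => exact congrArg _ (mul_assoc g x _)

/-- Every point of `X_ẇ^m(1)_{P_{1/2}}` has a representative satisfying both conditions. -/
lemma exists_rep (D : WildQuadraticData F E d) {n m : ℕ}
    {c : GL (Fin 2) E ⧸ levelSubgroup E (2 * m + 1)} (hc : c ∈ xHalf D n m) :
    ∃ x ∈ cell D n, (x : GL (Fin 2) E ⧸ levelSubgroup E (2 * m + 1)) = c ∧
      x⁻¹ * D.τG x ∈ DoubleCoset.doubleCoset (D.wDot n)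
        (levelSubgroup E (2 * m + 1) : Set (GL (Fin 2) E)) (levelSubgroup E (2 * m + 1)) := by
  obtain ⟨⟨x, hx, hx'⟩, y, ⟨a, ha, i, hi, rfl⟩, hyc⟩ := hc
  refine ⟨x, ?_, hx, by simpa using hx'⟩
  rw [← hx, QuotientGroup.eq] at hyc
  refine ⟨a, ha, _, mul_mem hi (levelSubgroup_le _ hyc), ?_⟩
  group

lemma mk_mem_xHalf (D : WildQuadraticData F E d) {n m : ℕ} {x : GL (Fin 2) E}
    (hx : x ∈ cell D n)
    (h : x⁻¹ * D.τG x ∈ DoubleCoset.doubleCoset (D.wDot n)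
        (levelSubgroup E (2 * m + 1) : Set (GL (Fin 2) E)) (levelSubgroup E (2 * m + 1))) :
    (x : GL (Fin 2) E ⧸ levelSubgroup E (2 * m + 1)) ∈ xHalf D n m :=
  ⟨⟨x, rfl, by simpa using h⟩, x, hx, rfl⟩

/-- An element of `Z(E) I_E` fixing `ẇ` under `τ`-conjugation lies in the preimage of `Γ̃`. -/
lemma mem_rawGamma (D : WildQuadraticData F E d) {n m : ℕ} {i : GL (Fin 2) E}
    (hi : i ∈ centerIwahori E) (hτ : D.τG i ∈ centerIwahori E)
    (h : D.wDot n * D.τG i = i * D.wDot n) : i ∈ rawGamma D n m := by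
  have hi' := Subgroup.mem_normalizer_iff.1 (centerIwahori_le_normalizer (2 * m + 1) hi)
  have hτ' := Subgroup.mem_normalizer_iff.1 (centerIwahori_le_normalizer (2 * m + 1) hτ)
  refine ⟨hi, fun y => ?_⟩
  simp only [DoubleCoset.mem_doubleCoset]
  constructor
  · rintro ⟨j, hj, k, hk, hy⟩
    refine ⟨i * j * i⁻¹, (hi' j).1 hj, D.τG i * k * (D.τG i)⁻¹, (hτ' k).1 hk, ?_⟩
    have : y = i * (i⁻¹ * y * D.τG i) * (D.τG i)⁻¹ := by group
    rw [this, hy]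
    have h' : i⁻¹ * D.wDot n * D.τG i = D.wDot n := by rw [mul_assoc, h, inv_mul_cancel_left]
    calc i * (j * D.wDot n * k) * (D.τG i)⁻¹
        = i * (j * (i⁻¹ * D.wDot n * D.τG i) * k) * (D.τG i)⁻¹ := by rw [h']
      _ = _ := by group
  · rintro ⟨j, hj, k, hk, rfl⟩
    refine ⟨i⁻¹ * j * i, ?_, (D.τG i)⁻¹ * k * D.τG i, ?_, ?_⟩
    · have := (hi' (i⁻¹ * j * i)).2
      simp only [mul_assoc, mul_inv_cancel_left, mul_inv_cancel, mul_one] at this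
      simpa [mul_assoc] using this hj
    · have := (hτ' ((D.τG i)⁻¹ * k * D.τG i)).2
      simp only [mul_assoc, mul_inv_cancel_left, mul_inv_cancel, mul_one] at this
      simpa [mul_assoc] using this hk
    · have h' : i * D.wDot n * (D.τG i)⁻¹ = D.wDot n := by
        rw [← h, mul_inv_cancel_right]
      calc i⁻¹ * (j * D.wDot n * k) * D.τG i
          = i⁻¹ * (j * (i * D.wDot n * (D.τG i)⁻¹) * k) * D.τG i := by rw [h']
        _ = _ := by group

lemma iwahori_le_centerIwahori : iwahori E ≤ centerIwahori E := le_sup_right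

lemma conj_mem_iwahori {i g : GL (Fin 2) E} (hi : i ∈ centerIwahori E) (hg : g ∈ iwahori E) :
    i * g * i⁻¹ ∈ iwahori E := by
  have h : centerIwahori E ≤ Subgroup.normalizer (iwahori E : Set (GL (Fin 2) E)) :=
    sup_le (Subgroup.center_le_normalizer _) Subgroup.le_normalizer
  exact (Subgroup.mem_normalizer_iff.1 (h hi) g).1 hg

lemma diag_mul {R : Type*} [CommRing R] (x y z w : Rˣ) :
    diag (x * z) (y * w) = diag x y * diag z w := by
  ext i j
  fin_cases i <;> fin_cases j <;> simp [diag]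

lemma diag_one {R : Type*} [CommRing R] : diag (1 : Rˣ) 1 = 1 := by
  ext i j
  fin_cases i <;> fin_cases j <;> simp [diag]

lemma diag_comm {R : Type*} [CommRing R] (x : Rˣ) (g : GL (Fin 2) R) : g * diag x x = diag x x * g := by
  ext i j
  fin_cases i <;> fin_cases j <;>
    simp [diag, Matrix.mul_apply, Fin.sum_univ_two, mul_comm]

/-- Diagonal matrices whose entries have equal valuation lie in `Z(E) I_E`. -/
lemma diag_mem {x y : Eˣ} {j : ℤ} (hx : ord E (x : E) = (j : WithTop ℤ))
    (hy : ord E (y : E) = (j : WithTop ℤ)) : diag x y ∈ centerIwahori E := by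
  have h : diag x y = diag x x * diag 1 (x⁻¹ * y) := by
    rw [← diag_mul, mul_one, mul_inv_cancel_left]
  rw [h]
  refine mul_mem (Subgroup.mem_sup_left ?_) (iwahori_le_centerIwahori ?_)
  · exact Subgroup.mem_center_iff.2 fun g => diag_comm x g
  · refine ⟨?_, ?_, ?_, ?_⟩
    · simp [diag, ord_one]
    · simp [diag, zero_mem]
    · simp [diag, zero_mem]
    · simpa [diag] using ord_mul_of (ord_inv_of hx rfl) hy (k := 0) (by omega)

lemma ord_τU [CharP F 2] (D : WildQuadraticData F E d) (t : Eˣ) :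
    ∃ j : ℤ, ord E (t : E) = (j : WithTop ℤ) ∧ ord E (D.τU t : E) = (j : WithTop ℤ) := by
  obtain ⟨j, hj⟩ := exists_ord t.ne_zero
  exact ⟨j, hj, D.ord_τ hj⟩

lemma τU_τU [CharP F 2] (D : WildQuadraticData F E d) (t : Eˣ) : D.τU (D.τU t) = t :=
  Units.ext (D.τ_τ t)

lemma τG_diag (D : WildQuadraticData F E d) (x y : Eˣ) :
    D.τG (diag x y) = diag (D.τU x) (D.τU y) := by
  ext i j
  fin_cases i <;> fin_cases j <;>
    simp [diag, WildQuadraticData.τG, WildQuadraticData.τU]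

lemma antidiag_mul_diag {R : Type*} [CommRing R] (x y z w : Rˣ) :
    antidiag x y * diag z w = diag w z * antidiag x y := by
  ext i j
  fin_cases i <;> fin_cases j <;> simp [diag, antidiag, mul_comm]

lemma diag_mem_rawGamma [CharP F 2] (D : WildQuadraticData F E d) (n m : ℕ) (t : Eˣ) :
    diag t (D.τU t) ∈ rawGamma D n m := by
  obtain ⟨j, h1, h2⟩ := ord_τU D t
  refine mem_rawGamma D (diag_mem h1 h2) ?_ ?_
  · rw [τG_diag, τU_τU]
    exact diag_mem h2 h1
  · rw [τG_diag, τU_τU, WildQuadraticData.wDot, mul_assoc, ← diag_mul, mul_comm _ (D.τU t),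
      mul_comm _ t, diag_mul, ← mul_assoc, antidiag_mul_diag, mul_assoc]

/-- The homomorphism `E^× → Γ̃`, `t ↦ i(t, 0) = e_0(t, τ(t))`. -/
def torusHom [CharP F 2] (D : WildQuadraticData F E d) (n m : ℕ) : Eˣ →* GammaTilde D n m :=
  (toGammaTilde D n m).comp
    { toFun := fun t => ⟨diag t (D.τU t), diag_mem_rawGamma D n m t⟩
      map_one' := by
        ext1
        simp [diag_one]
      map_mul' := fun s t => by
        ext1
        simp [diag_mul] }

/-- The level of a character `χ` of `E^×`: the smallest `k ≥ 0` such that `χ` is trivial on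
`U_E^(k+1) = 1 + 𝔭_E^(k+1)`. -/
noncomputable def charLevel {K : Type*} [Field K] (χ : Eˣ →* Kˣ) : ℕ :=
  sInf {k : ℕ | ∀ t : Eˣ, (t : E) - 1 ∈ pPow E ((k : ℤ) + 1) → χ t = 1}

/-- A matrix with entries of suitable valuations moves `v̇ I_E` into `C_v(a_1 ≠ 0)`. -/
lemma mul_mem_cell (D : WildQuadraticData F E d) {n : ℕ} {P i : GL (Fin 2) E}
    (h00 : ord E (P 0 0) = (0 : ℤ)) (h10 : ord E (P 1 0) = (1 : ℤ))
    (h01 : P 0 1 ∈ pPow E (-(n + d : ℤ)))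
    (hdet : ord E (P 0 0 * P 1 1 - P 0 1 * P 1 0) = (0 : ℤ)) (hi : i ∈ iwahori E) :
    P * D.vDot n * i ∈ cell D n := by
  have hP : P 0 0 ≠ 0 := ne_zero_of_ord h00
  have hinv := ord_inv_of h00 (k := 0) (by omega)
  set a : E := P 1 0 * (P 0 0)⁻¹ with ha
  have haord : ord E a = (1 : ℤ) := ord_mul_of h10 hinv (by omega)
  refine ⟨a, haord, (D.vDot n)⁻¹ * ((eMinus a)⁻¹ * P) * D.vDot n * i, mul_mem ?_ hi, ?_⟩
  · obtain ⟨e, he⟩ := D.d_odd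
    have hπ := D.π_ne_zero
    have hpow : ∀ k : ℕ, ord E (D.π ^ k) = ((k : ℤ) : WithTop ℤ) := by
      intro k
      induction k with
      | zero => simp [ord_one]
      | succ k ih =>
        rw [pow_succ]
        exact ord_mul_of ih D.ord_π' (by push_cast; rfl)
    have hmat : ((((D.vDot n)⁻¹ * ((eMinus a)⁻¹ * P) * D.vDot n : GL (Fin 2) E)) :
        Matrix (Fin 2) (Fin 2) E) =
        !![P 1 1 - a * P 0 1, 0;
          D.π ^ ((d + 1) / 2 + (n + 1) / 2) * D.π ^ ((d + 1) / 2 + n / 2) * P 0 1, P 0 0] := by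
      have e1 : ((eMinus a)⁻¹ : GL (Fin 2) E).val = !![1, 0; -a, 1] := rfl
      have e2 : ((D.vDot n)⁻¹ : GL (Fin 2) E).val =
        !![0, (D.π ^ ((d + 1) / 2 + n / 2))⁻¹; D.π ^ ((d + 1) / 2 + (n + 1) / 2), 0] := by
        change (D.vDot n).inv = _
        simp [WildQuadraticData.vDot, antidiag, WildQuadraticData.πU]
      have e3 : (D.vDot n).val =
        !![0, (D.π ^ ((d + 1) / 2 + (n + 1) / 2))⁻¹; D.π ^ ((d + 1) / 2 + n / 2), 0] := by
        ext i j
        fin_cases i <;> fin_cases j <;>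
          simp [WildQuadraticData.vDot, antidiag, WildQuadraticData.πU]
      have hz : P 1 0 = a * P 0 0 := by rw [ha, inv_mul_cancel_right₀ hP]
      have e4 : P.val = !![P 0 0, P 0 1; a * P 0 0, P 1 1] := by
        rw [← hz]
        exact Matrix.eta_fin_two _
      rw [Units.val_mul, Units.val_mul, Units.val_mul, e1, e2, e3, e4]
      have hr := pow_ne_zero ((d + 1) / 2 + n / 2) hπ
      have hs := pow_ne_zero ((d + 1) / 2 + (n + 1) / 2) hπ
      clear e1 e2 e3 e4
      generalize D.π ^ ((d + 1) / 2 + (n + 1) / 2) = s at hs ⊢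
      generalize D.π ^ ((d + 1) / 2 + n / 2) = r at hr ⊢
      ext i j
      fin_cases i <;> fin_cases j <;> simp <;> field_simp <;> ring
    refine ⟨?_, ?_, ?_, ?_⟩ <;> rw [hmat]
    · have : P 1 1 - a * P 0 1 = (P 0 0 * P 1 1 - P 0 1 * P 1 0) * (P 0 0)⁻¹ := by
        rw [ha]
        field_simp
      simp only [Matrix.of_apply, Matrix.cons_val', Matrix.cons_val_zero]
      rw [this]
      exact ord_mul_of hdet hinv (by omega)
    · simp [zero_mem]
    · refine mul_mem_pPow (mem_pPow_of_ord (ord_mul_of (hpow _) (hpow _) rfl)) h01 ?_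
      omega
    · exact h00
  · group

lemma ord_det_of_mem_iwahori {g : GL (Fin 2) E} (hg : g ∈ iwahori E) :
    ord E (g 0 0 * g 1 1 - g 0 1 * g 1 0) = (0 : ℤ) := by
  obtain ⟨g1, g2, g3, g4⟩ := hg
  rw [sub_eq_add_neg]
  exact ord_add_of (ord_mul_of g1 g4 (by omega)) (neg_mem (mul_mem_pPow g2 g3 (by omega)))

lemma τG_incl (D : WildQuadraticData F E d) (g : GL (Fin 2) F) :
    D.τG (D.incl g) = D.incl g := by
  ext i j
  simp [WildQuadraticData.τG, WildQuadraticData.incl]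

lemma cond_mul_left (D : WildQuadraticData F E d) (g : GL (Fin 2) F) (x : GL (Fin 2) E) :
    (D.incl g * x)⁻¹ * D.τG (D.incl g * x) = x⁻¹ * D.τG x := by
  rw [map_mul, τG_incl]
  group

lemma subset_XTilde (D : WildQuadraticData F E d) {n m : ℕ}
    {c : GL (Fin 2) E ⧸ levelSubgroup E (2 * m + 1)} (hc : c ∈ xHalf D n m) :
    c ∈ XTilde D n m :=
  ⟨1, c, hc, by rw [map_one]; rfl⟩

lemma stable_of_xHalf (D : WildQuadraticData F E d) {n m : ℕ} {g : GL (Fin 2) E}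
    (h : ∀ c ∈ xHalf D n m, g • c ∈ XTilde D n m) :
    ∀ c ∈ XTilde D n m, g • c ∈ XTilde D n m := by
  rintro _ ⟨γ, c, hc, rfl⟩
  rw [← gammaAction_smul]
  exact gammaAction_mem D n m γ (h c hc)

lemma iwahori_stable (D : WildQuadraticData F E d) {n m : ℕ} {g : GL (Fin 2) F}
    (hg : g ∈ iwahori F) : ∀ c ∈ XTilde D n m, D.incl g • c ∈ XTilde D n m := by
  refine stable_of_xHalf D fun c hc => ?_
  obtain ⟨x, ⟨a, ha, i, hi, rfl⟩, rfl, hx⟩ := exists_rep D hc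
  refine subset_XTilde D (mk_mem_xHalf D (x := D.incl g * (eMinus a * D.vDot n * i)) ?_
    (by rwa [cond_mul_left]))
  have hgE : D.incl g ∈ iwahori E := by
    obtain ⟨g1, g2, g3, g4⟩ := hg
    exact ⟨D.ord_algebraMap_of g1 rfl, D.algebraMap_mem_pPow g2 (by omega),
      D.algebraMap_mem_pPow g3 (by omega), D.ord_algebraMap_of g4 rfl⟩
  have h3 : D.incl g 1 0 ∈ pPow E 2 := D.algebraMap_mem_pPow hg.2.2.1 (by omega)
  have hdet := ord_det_of_mem_iwahori hgE
  obtain ⟨g1, g2, -, g4⟩ := hgE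
  have ha' : ord E a = (1 : ℤ) := ha
  have hmat : (D.incl g * eMinus a : GL (Fin 2) E).val =
      !![D.incl g 0 0 + D.incl g 0 1 * a, D.incl g 0 1;
        D.incl g 1 0 + D.incl g 1 1 * a, D.incl g 1 1] := by
    rw [Units.val_mul, Matrix.eta_fin_two (D.incl g).val]
    ext i j
    fin_cases i <;> fin_cases j <;> simp [eMinus]
  rw [← mul_assoc, ← mul_assoc]
  refine mul_mem_cell D ?_ ?_ ?_ ?_ hi <;> rw [hmat]
  · exact ord_add_of g1 (mul_mem_pPow g2 (mem_pPow_of_ord ha') (by omega))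
  · change ord E (D.incl g 1 0 + D.incl g 1 1 * a) = _
    rw [add_comm]
    exact ord_add_of (ord_mul_of g4 ha' (by omega)) h3
  · exact pPow_mono (by omega) g2
  · rw [← hdet]
    congr 1
    simp
    ring

lemma scalar_stable [CharP F 2] (D : WildQuadraticData F E d) {n m : ℕ} (z : Fˣ) :
    ∀ c ∈ XTilde D n m, D.incl (diag z z) • c ∈ XTilde D n m := by
  intro c hc
  set t : Eˣ := Units.map (algebraMap F E : F →* E) z with ht
  have h1 : D.incl (diag z z) = diag t t := by
    ext i j
    fin_cases i <;> fin_cases j <;> simp [diag, WildQuadraticData.incl, ht]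
  have h2 : D.τU t = t := by
    ext
    simp [WildQuadraticData.τU, ht]
  have h3 : D.incl (diag z z) • c = gammaAction D n m (torusHom D n m t⁻¹) c := by
    induction c using QuotientGroup.induction_on with
    | H x =>
      change QuotientGroup.mk (D.incl (diag z z) * x) =
        QuotientGroup.mk (x * (diag t⁻¹ (D.τU t⁻¹))⁻¹)
      have h4 : (diag t⁻¹ (D.τU t⁻¹))⁻¹ = diag t t := by
        rw [inv_eq_iff_mul_eq_one, map_inv, h2, ← diag_mul, inv_mul_cancel, diag_one]
      rw [h4, h1, diag_comm]
  rw [h3]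
  exact gammaAction_mem D n m _ hc

lemma ι_π_stable [CharP F 2] (D : WildQuadraticData F E d) {n m : ℕ} :
    ∀ c ∈ XTilde D n m, D.incl (D.ιU D.πU) • c ∈ XTilde D n m := by
  have hchar : CharP E 2 := charP_of_injective_algebraMap (algebraMap F E).injective 2
  refine stable_of_xHalf D fun c hc => ?_
  obtain ⟨x, ⟨a, ha, i, hi, rfl⟩, rfl, hx⟩ := exists_rep D hc
  set x : GL (Fin 2) E := eMinus a * D.vDot n * i with hxdef
  set γ : GL (Fin 2) E := diag D.πU (D.τU D.πU) with hγ
  have hγmem : γ ∈ rawGamma D n m := diag_mem_rawGamma D n m D.πU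
  have hmk : D.incl (D.ιU D.πU) •
      (QuotientGroup.mk x : GL (Fin 2) E ⧸ levelSubgroup E (2 * m + 1)) =
      gammaAction D n m (toGammaTilde D n m ⟨γ, hγmem⟩⁻¹)
        (QuotientGroup.mk (D.incl (D.ιU D.πU) * x * γ⁻¹)) := by
    rw [gammaAction_mk]
    change QuotientGroup.mk (D.incl (D.ιU D.πU) * x) =
      QuotientGroup.mk (D.incl (D.ιU D.πU) * x * γ⁻¹ * γ⁻¹⁻¹)
    rw [inv_inv, inv_mul_cancel_right]
  rw [hmk]
  refine gammaAction_mem D n m _ (subset_XTilde D (mk_mem_xHalf D ?_ ?_))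
  swap
  · have := ((inv_mem hγmem).2 (x⁻¹ * D.τG x)).2 hx
    have e : (D.incl (D.ιU D.πU) * x * γ⁻¹)⁻¹ * D.τG (D.incl (D.ιU D.πU) * x * γ⁻¹) =
        γ⁻¹⁻¹ * (x⁻¹ * D.τG x) * D.τG γ⁻¹ := by
      rw [map_mul, map_mul, τG_incl]
      group
    rwa [e]
  have hv : D.vDot n * γ⁻¹ = (diag (D.τU D.πU) D.πU)⁻¹ * D.vDot n := by
    rw [mul_inv_eq_iff_eq_mul, mul_assoc, eq_inv_mul_iff_mul_eq, hγ,
      WildQuadraticData.vDot, antidiag_mul_diag]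
  have hfac : D.incl (D.ιU D.πU) * x * γ⁻¹ =
      D.incl (D.ιU D.πU) * eMinus a * (diag (D.τU D.πU) D.πU)⁻¹ * D.vDot n *
        (γ * i * γ⁻¹) := by
    calc D.incl (D.ιU D.πU) * x * γ⁻¹
        = D.incl (D.ιU D.πU) * eMinus a * (D.vDot n * γ⁻¹) * (γ * i * γ⁻¹) := by
          rw [hxdef]
          group
      _ = _ := by
          rw [hv]
          group
  rw [hfac]
  have hπ := D.π_ne_zero
  have hτπ : D.τ D.π ≠ 0 := ne_zero_of_ord D.ord_τ_π
  have ha' : ord E a = (1 : ℤ) := ha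
  have hϖ : algebraMap F E D.ϖ = D.π * D.τ D.π := by
    rw [D.τ_π, ← sub_eq_zero, CharTwo.sub_eq_add]
    linear_combination D.minpoly_π
  have e1 : (D.incl (D.ιU D.πU)).val =
      !![algebraMap F E D.Δ, 1; algebraMap F E D.ϖ, 0] := by
    have : (D.ιU D.πU).val = !![D.Δ, 1; D.ϖ, 0] := D.ι_π
    ext i j
    change algebraMap F E ((D.ιU D.πU).val i j) = _
    rw [this]
    fin_cases i <;> fin_cases j <;> simp
  have e2 : ((diag (D.τU D.πU) D.πU)⁻¹ : GL (Fin 2) E).val =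
      !![(D.τ D.π)⁻¹, 0; 0, D.π⁻¹] := by
    change (diag (D.τU D.πU) D.πU).inv = _
    simp [diag, WildQuadraticData.τU, WildQuadraticData.πU]
  have hmat : (D.incl (D.ιU D.πU) * eMinus a * (diag (D.τU D.πU) D.πU)⁻¹ :
      GL (Fin 2) E).val =
      !![(algebraMap F E D.Δ + a) * (D.τ D.π)⁻¹, D.π⁻¹; D.π, 0] := by
    rw [Units.val_mul, Units.val_mul, e1, e2, hϖ]
    generalize algebraMap F E D.Δ = δ
    ext i j
    fin_cases i <;> fin_cases j <;> simp [eMinus, hτπ]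
  have hd := D.d_pos
  refine mul_mem_cell D ?_ ?_ ?_ ?_ (conj_mem_iwahori hγmem.1 hi) <;> rw [hmat]
  · refine ord_mul_of ?_ (ord_inv_of D.ord_τ_π rfl) (i := 1) (by omega)
    rw [add_comm]
    exact ord_add_of ha' (pPow_mono (by omega) (mem_pPow_of_ord D.ord_Δ'))
  · exact D.ord_π'
  · refine pPow_mono ?_ (mem_pPow_of_ord (ord_inv_of D.ord_π' rfl))
    omega
  · simp [hπ, ord_neg, ord_one]

lemma ι_unit_mem [CharP F 2] (D : WildQuadraticData F E d) {t : Eˣ}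
    (ht : ord E (t : E) = (0 : ℤ)) : D.ιU t ∈ iwahori F := by
  obtain ⟨a, b, hab⟩ := D.exists_coords (t : E)
  have hval : (D.ιU t).val = !![a + b * D.Δ, b; b * D.ϖ, a] := by
    rw [← D.ι_coords, ← hab]
    rfl
  rw [hab] at ht
  have hmem := D.coords_mem (mem_pPow_of_ord ht)
  have hb : b ∈ pPow F 0 := by
    by_cases hb0 : b = 0
    · simp [hb0, zero_mem]
    obtain ⟨k, hk⟩ := exists_ord hb0
    have h := hmem.2
    rw [mem_pPow, ord_mul_of (D.ord_algebraMap_of hk rfl) D.ord_π' rfl, WithTop.coe_le_coe] at h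
    exact pPow_mono (by omega) (mem_pPow_of_ord hk)
  have ha : ord F a = (0 : ℤ) := by
    have hbπ : algebraMap F E b * D.π ∈ pPow E 1 :=
      mul_mem_pPow (D.algebraMap_mem_pPow hb le_rfl) (mem_pPow_of_ord D.ord_π') (by omega)
    have h0 : ord E (algebraMap F E a) = (0 : ℤ) := by
      have := ord_add_of ht (neg_mem hbπ)
      rwa [add_neg_cancel_right] at this
    have ha0 : a ≠ 0 := by
      rintro rfl
      exact ne_zero_of_ord h0 (map_zero _)
    obtain ⟨k, hk⟩ := exists_ord ha0
    rw [D.ord_algebraMap_of hk rfl, WithTop.coe_eq_coe] at h0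
    rw [hk, WithTop.coe_eq_coe]
    omega
  have hd := D.d_pos
  refine ⟨?_, ?_, ?_, ?_⟩ <;> rw [hval]
  · exact ord_add_of ha (mul_mem_pPow hb (mem_pPow_of_ord D.ord_Δ) (by omega))
  · exact hb
  · exact mul_mem_pPow hb (mem_pPow_of_ord (j := 1) D.ord_ϖ) (by omega)
  · exact ha

lemma ord_zpow {x : F} (hx : ord F x = (1 : ℤ)) (k : ℤ) : ord F (x ^ k) = (k : WithTop ℤ) := by
  have hx0 := ne_zero_of_ord hx
  induction k with
  | zero => simp [ord_one]
  | succ k ih =>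
    rw [zpow_add_one₀ hx0]
    exact ord_mul_of ih hx rfl
  | pred k ih =>
    rw [zpow_sub_one₀ hx0]
    exact ord_mul_of ih (ord_inv_of hx rfl) rfl

lemma ι_stable [CharP F 2] (D : WildQuadraticData F E d) {n m : ℕ} (t : Eˣ) :
    ∀ c ∈ XTilde D n m, D.incl (D.ιU t) • c ∈ XTilde D n m := by
  have hmul : ∀ s t : Eˣ, (∀ c ∈ XTilde D n m, D.incl (D.ιU s) • c ∈ XTilde D n m) →
      (∀ c ∈ XTilde D n m, D.incl (D.ιU t) • c ∈ XTilde D n m) →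
      ∀ c ∈ XTilde D n m, D.incl (D.ιU (s * t)) • c ∈ XTilde D n m := by
    intro s t hs ht c hc
    rw [map_mul, map_mul, mul_smul]
    exact hs _ (ht _ hc)
  have hscal : ∀ z : Fˣ, ∀ c ∈ XTilde D n m,
      D.incl (D.ιU (Units.map (algebraMap F E : F →* E) z)) • c ∈ XTilde D n m := by
    intro z
    have : D.ιU (Units.map (algebraMap F E : F →* E) z) = diag z z := by
      ext i j
      have := congrFun (congrFun (D.ι_coords (z : F) 0) i) j
      simp only [map_zero, zero_mul, add_zero] at this
      exact this
    rw [this]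
    exact scalar_stable D z
  have hϖ0 : D.ϖ ≠ 0 := ne_zero_of_ord (j := 1) D.ord_ϖ
  obtain ⟨j, hj⟩ := exists_ord t.ne_zero
  set z : Fˣ := Units.mk0 (D.ϖ ^ (j / 2)) (zpow_ne_zero _ hϖ0) with hz
  set zE : Eˣ := Units.map (algebraMap F E : F →* E) z with hzE
  have hzord : ord E (zE : E) = ((j / 2 + j / 2 : ℤ) : WithTop ℤ) :=
    D.ord_algebraMap_of (ord_zpow D.ord_ϖ (j / 2)) rfl
  have hzinv : ord E ((zE⁻¹ : Eˣ) : E) = ((-(j / 2 + j / 2) : ℤ) : WithTop ℤ) := by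
    rw [Units.val_inv_eq_inv_val]
    exact ord_inv_of hzord rfl
  rcases Int.emod_two_eq_zero_or_one j with h | h
  · have hu : ord E ((zE⁻¹ * t : Eˣ) : E) = (0 : ℤ) := ord_mul_of hzinv hj (by omega)
    rw [show t = zE * (zE⁻¹ * t) by group]
    exact hmul _ _ (hscal z) (iwahori_stable D (ι_unit_mem D hu))
  · have hπinv : ord E ((D.πU⁻¹ : Eˣ) : E) = ((-1 : ℤ) : WithTop ℤ) := by
      rw [Units.val_inv_eq_inv_val]
      exact ord_inv_of D.ord_π' rfl
    have hu : ord E ((D.πU⁻¹ * (zE⁻¹ * t) : Eˣ) : E) = (0 : ℤ) :=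
      ord_mul_of hπinv (ord_mul_of hzinv hj rfl) (by omega)
    rw [show t = zE * (D.πU * (D.πU⁻¹ * (zE⁻¹ * t))) by group]
    exact hmul _ _ (hscal z) (hmul _ _ (ι_π_stable D) (iwahori_stable D (ι_unit_mem D hu)))

/-- `X̃_ẇ^m(1)_{P_{1/2}}` is stable under left multiplication by `ι(E^×) I_F`. -/
lemma torusIwahori_stable [CharP F 2] (D : WildQuadraticData F E d) {n m : ℕ}
    {g : GL (Fin 2) F} (hg : g ∈ D.torusIwahori) :
    ∀ c ∈ XTilde D n m, D.incl g • c ∈ XTilde D n m := by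
  rw [WildQuadraticData.torusIwahori, Subgroup.sup_eq_closure] at hg
  induction hg using Subgroup.closure_induction'' with
  | mem x hx =>
    rcases hx with ⟨t, rfl⟩ | hx
    · exact ι_stable D t
    · exact iwahori_stable D hx
  | inv_mem x hx =>
    rcases hx with ⟨t, rfl⟩ | hx
    · rw [← map_inv]
      exact ι_stable D t⁻¹
    · exact iwahori_stable D (inv_mem hx)
  | one =>
    intro c hc
    simpa using hc
  | mul x y _ _ hx hy =>
    intro c hc
    rw [map_mul, mul_smul]
    exact hx _ (hy _ hc)

end Varieties

section Representations

/-- The restriction of a permutation action of `G` on `Y` to a stable subset `S`. -/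
def restrictHom {G Y : Type*} [Group G] (ρ : G →* Equiv.Perm Y) (S : Set Y)
    (h : ∀ g, ∀ c ∈ S, ρ g c ∈ S) : G →* Equiv.Perm S where
  toFun g := (ρ g).subtypePerm fun c => ⟨fun hc => by simpa using h g⁻¹ _ hc, h g c⟩
  map_one' := by
    ext c
    simp
  map_mul' g g' := by
    ext c
    exact congrFun (congrArg DFunLike.coe (map_mul ρ g g')) c.1

/-- For a discrete set `Y`, `H_c^0(Y, K)` is the space `Y →₀ K` of finitely supported functions;
a group acting on `Y` acts on it by `(g f)(y) = f(g⁻¹ y)`. -/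
noncomputable def cohomologyRep (K : Type*) [Field K] {G Y : Type*} [Group G]
    (ρ : G →* Equiv.Perm Y) : Representation K G (Y →₀ K) where
  toFun g := Finsupp.lmapDomain K K (ρ g)
  map_one' := by
    ext
    simp
  map_mul' g g' := by
    ext
    simp

lemma cohomologyRep_apply {K : Type*} [Field K] {G Y : Type*} [Group G]
    (ρ : G →* Equiv.Perm Y) (g : G) (f : Y →₀ K) (y : Y) :
    cohomologyRep K ρ g f y = f (ρ g⁻¹ y) := by
  have h : y = ρ g (ρ g⁻¹ y) := by simp
  conv_lhs => rw [h]
  exact Finsupp.mapDomain_apply (ρ g).injective f _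

/-- The span of the vectors `g v - χ(g) v`. -/
def isotypicKernel {K G V : Type*} [Field K] [Group G] [AddCommGroup V] [Module K V]
    (ρ : Representation K G V) (χ : G →* Kˣ) : Submodule K V :=
  Submodule.span K {w | ∃ (g : G) (v : V), w = ρ g v - (χ g : K) • v}

/-- The `χ`-isotypic part of `V`, i.e. the largest quotient of `V` on which `G` acts by `χ`. For
finite `G` in characteristic zero it is the same as the subspace on which `G` acts by `χ`; for
finitely supported functions on an infinite free `G`-set that subspace is zero. -/
abbrev IsotypicPart {K G V : Type*} [Field K] [Group G] [AddCommGroup V] [Module K V]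
    (ρ : Representation K G V) (χ : G →* Kˣ) : Type _ :=
  V ⧸ isotypicKernel ρ χ

/-- The representation on the `χ`-isotypic part of a group commuting with `G`. -/
def isotypicRep {K G H V : Type*} [Field K] [Group G] [Group H] [AddCommGroup V] [Module K V]
    (σ : Representation K H V) (ρ : Representation K G V) (χ : G →* Kˣ)
    (hcomm : ∀ (h : H) (g : G) (v : V), σ h (ρ g v) = ρ g (σ h v)) :
    Representation K H (IsotypicPart ρ χ) where
  toFun h := Submodule.mapQ _ _ (σ h) (by
    refine Submodule.span_le.2 ?_
    rintro _ ⟨g, v, rfl⟩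
    refine Submodule.subset_span ⟨g, σ h v, ?_⟩
    rw [map_sub, map_smul, hcomm])
  map_one' := by
    ext v
    simp
  map_mul' h h' := by
    ext v
    simp
    rfl

variable {F E : Type*} [Field F] [ValuativeRel F] [TopologicalSpace F]
  [IsNonarchimedeanLocalField F] [Field E] [ValuativeRel E] [TopologicalSpace E]
  [IsNonarchimedeanLocalField E] [Algebra F E] {d : ℕ}

/-- The action of `Γ̃` on `X̃_ẇ^m(1)_{P_{1/2}}`, by `(γ, xJ) ↦ x γ⁻¹ J`. -/
def rightAction (D : WildQuadraticData F E d) (n m : ℕ) :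
    GammaTilde D n m →* Equiv.Perm (XTilde D n m) :=
  restrictHom (gammaAction D n m) _ fun γ _ hc => gammaAction_mem D n m γ hc

/-- The action of `ι(E^×) I_F` on `X̃_ẇ^m(1)_{P_{1/2}}`, by left multiplication. -/
noncomputable def leftAction [CharP F 2] (D : WildQuadraticData F E d) (n m : ℕ) :
    D.torusIwahori →* Equiv.Perm (XTilde D n m) :=
  restrictHom (((MulAction.toPermHom (GL (Fin 2) E)
    (GL (Fin 2) E ⧸ levelSubgroup E (2 * m + 1))).comp D.incl).comp D.torusIwahori.subtype) _
    fun g => torusIwahori_stable D g.2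

/-- The representation `Ξ_χ` of `ι(E^×) I_F` on the `χ`-isotypic part of
`H_c^0(X̃_ẇ^m(1)_{P_{1/2}}, K)`, for a character `χ` of `Γ̃`. -/
noncomputable def Xi [CharP F 2] (D : WildQuadraticData F E d) (n m : ℕ) {K : Type*} [Field K]
    (χ : GammaTilde D n m →* Kˣ) :
    Representation K D.torusIwahori
      (IsotypicPart (cohomologyRep K (rightAction D n m)) χ) :=
  isotypicRep (cohomologyRep K (leftAction D n m)) (cohomologyRep K (rightAction D n m)) χ
    fun g γ f => by
      have h : (leftAction D n m g) ∘ (rightAction D n m γ) =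
          (rightAction D n m γ) ∘ (leftAction D n m g) := by
        funext c
        exact Subtype.ext (gammaAction_smul D n m γ (D.incl g.1) c.1).symm
      change Finsupp.mapDomain _ (Finsupp.mapDomain _ f) =
        Finsupp.mapDomain _ (Finsupp.mapDomain _ f)
      rw [← Finsupp.mapDomain_comp, ← Finsupp.mapDomain_comp, h]

/-- The element `e_-(u)` of `ι(E^×) I_F`, for `u ∈ 𝔭_F`. -/
noncomputable def unipotent (D : WildQuadraticData F E d) (u : F) (hu : 1 ≤ ord F u) :
    D.torusIwahori :=
  ⟨eMinus u, Subgroup.mem_sup_right (eMinus_mem_iwahori hu)⟩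

/-- The cardinality `q` of the residue field of `F`. -/
noncomputable def residueCard (F : Type*) [Field F] [ValuativeRel F] : ℕ :=
  Nat.card 𝓀[F]

end Representations

end WildGL2

namespace WildGL2

open ValuativeRel
open scoped MatrixGroups

/-! ### Isotypic part of the functions on a free `G`-set. -/

section FreeAction

variable {K G S A : Type*} [Field K] [Group G] (ρ : G →* Equiv.Perm S) (χ : G →* Kˣ)

/-! The group Γ̃ acts freely on X̃. Hence the θ̃-isotypic part of `H_c^0` has a basis indexed by the
Γ̃-orbits (`isotypicBasis`), and the trace of a permutation commuting with Γ̃ is the sum, over the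
orbits it preserves, of θ̃(γ), where γ is the element by which it moves the chosen point
(`trace_isotypic`).

Every coset `e_-(a) v̇ I_E` with `ord a = 1` contains an explicit solution of `g⁻¹ τ(g) = ẇ`, namely
`[[1, 1], [τ(a), a]]` times a diagonal matrix (`rep`): τ swaps the columns up to scalars, and the
diagonal turns these scalars into the entries of ẇ. Points of X over these cosets are in the same
Γ̃-orbit iff they agree modulo `E^× I_E`, that is, iff their parameters `a` are congruent modulo
`𝔭_E^(n+d+1)` (`orbitRep_bijective`).

Left multiplication by `e_-(u)` replaces `a` by `a + u`. So it preserves no orbit if `u ∉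
𝔭_E^(n+d+1)`, and every orbit otherwise. In the second case it acts on `rep` as right multiplication
by a unipotent matrix with parameter `u / (a + τ(a))` (`eMinus_mul_rep`). Writing `a = a₀ + π/b`
gives `a + τ(a) = Δ/b`, so the parameter `ub/Δ` is additive in `b`. The trace becomes `q^⌊(n+d)/2⌋`
times the sum of an additive character `ψ(b)` over the units `b` modulo `𝔭_F^⌊(n+d+1)/2⌋`, i.e. the
sum over `O_F` minus the sum over `𝔭_F`.

It remains to see where ψ is trivial. When `ub/Δ ∈ 𝔭_E^m`, the unipotent matrix is the scalar `1 +
ub/Δ` times a matrix with diagonal entries 1 on which θ̃ vanishes as a character, because modulo J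
it is a commutator with `diag(π, τ(π))` (`char_off`). Hence `ψ(b) = θ(1 + ub/Δ)` (`char_unip`).
Since `m` is even, level `m` means that θ is already non-trivial on `1 + 𝔭_F^(m/2)`
(`exists_char_ne_one`). As `ord Δ = (d+1)/2`, the character ψ is trivial on `𝔭_F^i` exactly when
`ord u ≥ n + d + 1 - i`; the values `i = 0, 1` separate the three cases. -/

lemma cohomologyRep_single (g : G) (s : S) (c : K) :
    cohomologyRep K ρ g (Finsupp.single s c) = Finsupp.single (ρ g s) c :=
  Finsupp.mapDomain_single

/-- The defining relations of the quotient turn translation by `g` into multiplication by `χ g`, so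
one point per orbit suffices to span it. -/
lemma mk_single_smul (g : G) (s : S) :
    (isotypicKernel (cohomologyRep K ρ) χ).mkQ (Finsupp.single (ρ g s) 1) =
      (χ g : K) • (isotypicKernel (cohomologyRep K ρ) χ).mkQ (Finsupp.single s 1) := by
  rw [← map_smul, ← sub_eq_zero, ← map_sub, Submodule.mkQ_apply, Submodule.Quotient.mk_eq_zero]
  exact Submodule.subset_span ⟨g, Finsupp.single s 1, by rw [cohomologyRep_single]⟩

variable (x : A → S) (hx : Function.Bijective fun p : G × A => ρ p.1 (x p.2))

/-- The linear map sending `γ · x a` to `χ γ` times the basis vector of index `a`. -/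
noncomputable def orbitCoord : (S →₀ K) →ₗ[K] (A →₀ K) :=
  Finsupp.linearCombination K fun s =>
    Finsupp.single ((Equiv.ofBijective _ hx).symm s).2 (χ ((Equiv.ofBijective _ hx).symm s).1 : K)

lemma orbitCoord_single (g : G) (a : A) :
    orbitCoord ρ χ x hx (Finsupp.single (ρ g (x a)) 1) = Finsupp.single a (χ g : K) := by
  have h : (Equiv.ofBijective _ hx).symm (ρ g (x a)) = (g, a) :=
    (Equiv.ofBijective _ hx).symm_apply_apply (g, a)
  simp [orbitCoord, h]

/-- On a point `γ · x a` the claim is the multiplicativity of `χ`. It lets `orbitCoord` descend to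
the isotypic part, where it inverts the spanning map of `isotypicBasis`. -/
lemma isotypicKernel_le : isotypicKernel (cohomologyRep K ρ) χ ≤ (orbitCoord ρ χ x hx).ker := by
  refine Submodule.span_le.2 ?_
  rintro _ ⟨g, v, rfl⟩
  rw [SetLike.mem_coe, LinearMap.mem_ker, map_sub, sub_eq_zero, map_smul]
  suffices h : (orbitCoord ρ χ x hx).comp (cohomologyRep K ρ g) =
      (χ g : K) • orbitCoord ρ χ x hx from congrArg (fun f => f v) h
  refine Finsupp.lhom_ext' fun s => LinearMap.ext_ring ?_
  obtain ⟨⟨γ, a⟩, rfl⟩ := hx.2 s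
  simp only [LinearMap.comp_apply, Finsupp.lsingle_apply, cohomologyRep_single,
    LinearMap.smul_apply, orbitCoord_single]
  rw [← Equiv.Perm.mul_apply, ← map_mul, orbitCoord_single]
  simp

/-- If `G` acts freely on `S` and `x` is a family of representatives of the orbits, then the images
of the `x a` form a basis of the `χ`-isotypic part of the space of finitely supported functions. -/
noncomputable def isotypicBasis :
    Module.Basis A K (IsotypicPart (cohomologyRep K ρ) χ) :=
  Module.Basis.ofRepr <| LinearEquiv.ofLinearMap
    (Submodule.liftQ _ (orbitCoord ρ χ x hx) (isotypicKernel_le ρ χ x hx))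
    (Finsupp.linearCombination K fun a =>
      (isotypicKernel (cohomologyRep K ρ) χ).mkQ (Finsupp.single (x a) 1))
    (by
      refine Finsupp.lhom_ext' fun a => LinearMap.ext_ring ?_
      have := orbitCoord_single ρ χ x hx 1 a
      simpa using this)
    (by
      refine Submodule.linearMap_qext _ (Finsupp.lhom_ext' fun s => LinearMap.ext_ring ?_)
      obtain ⟨⟨γ, a⟩, rfl⟩ := hx.2 s
      simp only [LinearMap.comp_apply, Finsupp.lsingle_apply, Submodule.mkQ_apply,
        Submodule.liftQ_apply, orbitCoord_single, Finsupp.linearCombination_single]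
      exact (mk_single_smul ρ χ γ (x a)).symm)

lemma isotypicBasis_apply (a : A) : isotypicBasis ρ χ x hx a =
    (isotypicKernel (cohomologyRep K ρ) χ).mkQ (Finsupp.single (x a) 1) := by
  change Finsupp.linearCombination K _ (Finsupp.single a 1) = _
  simp

lemma isotypicBasis_repr (g : G) (a : A) : (isotypicBasis ρ χ x hx).repr
    ((isotypicKernel (cohomologyRep K ρ) χ).mkQ (Finsupp.single (ρ g (x a)) 1)) =
      Finsupp.single a (χ g : K) :=
  orbitCoord_single ρ χ x hx g a

/-- The trace on the isotypic part of an operator permuting the points of `S`. -/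
lemma trace_isotypic [Fintype A] (x : A → S)
    (hx : Function.Bijective fun p : G × A => ρ p.1 (x p.2))
    (T : Module.End K (IsotypicPart (cohomologyRep K ρ) χ))
    (t : S → S) (hT : ∀ s, T ((isotypicKernel (cohomologyRep K ρ) χ).mkQ (Finsupp.single s 1)) =
      (isotypicKernel (cohomologyRep K ρ) χ).mkQ (Finsupp.single (t s) 1))
    (f : A → K) (hf₀ : ∀ a, (∀ g, t (x a) ≠ ρ g (x a)) → f a = 0)
    (hf : ∀ a g, t (x a) = ρ g (x a) → f a = χ g) :
    LinearMap.trace _ _ T = ∑ a, f a := by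
  classical
  rw [LinearMap.trace_eq_matrix_trace K (isotypicBasis ρ χ x hx), Matrix.trace]
  refine Finset.sum_congr rfl fun a _ => ?_
  rw [Matrix.diag_apply, LinearMap.toMatrix_apply, isotypicBasis_apply, hT]
  -- The column of index `a` has a single non-zero entry `χ g`, in row `a'`; it contributes to the
  -- trace only if `a' = a`.
  obtain ⟨⟨g, a'⟩, h⟩ := hx.2 (t (x a))
  simp only at h
  rw [← h, isotypicBasis_repr]
  by_cases haa : a' = a
  · subst haa
    rw [hf a' g h.symm, Finsupp.single_eq_same]
  · rw [Finsupp.single_eq_of_ne' haa, hf₀]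
    intro g' hg'
    rw [← h] at hg'
    exact haa (congrArg Prod.snd (hx.1 (a₁ := (g, a')) (a₂ := (g', a)) hg'))

end FreeAction

/-! ### Sums of additive characters over a finite group and off a subgroup. -/

section Sums

variable {H K : Type*} [AddCommGroup H] [Fintype H] [Field K]

open Classical in
lemma sum_addChar (ψ : AddChar H K) :
    ∑ h, ψ h = if ∀ h, ψ h = 1 then (Nat.card H : K) else 0 := by
  split_ifs with hψ
  · simp [hψ, Nat.card_eq_fintype_card]
  · exact AddChar.sum_eq_zero_of_ne_one fun h => hψ fun x => by simp [h]

open Classical in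
/-- The sum of an additive character over the complement of a subgroup. -/
lemma sum_addChar_compl (H' : AddSubgroup H) (ψ : AddChar H K) :
    ∑ h : {h : H // h ∉ H'}, ψ h = (if ∀ h, ψ h = 1 then (Nat.card H : K) else 0) -
      if ∀ h ∈ H', ψ h = 1 then (Nat.card H' : K) else 0 := by
  have h1 := sum_addChar (ψ.compAddMonoidHom H'.subtype)
  have h2 : (∑ h : {h : H // h ∈ H'}, ψ h) + ∑ h : {h : H // h ∉ H'}, ψ h = ∑ h, ψ h :=
    Fintype.sum_subtype_add_sum_subtype (fun h => h ∈ H') ψ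
  rw [← sum_addChar, ← h2, eq_sub_iff_add_eq', add_left_inj]
  simp only [AddChar.compAddMonoidHom_apply, AddSubgroup.coe_subtype, Subtype.forall] at h1
  exact h1.symm

end Sums

/-! ### Orders of quotients of fractional ideals. -/

section Quotients

variable {L : Type*} [Field L] [ValuativeRel L] [TopologicalSpace L]
  [IsNonarchimedeanLocalField L]

lemma mem_pPow_zero_iff {x : L} : x ∈ pPow L 0 ↔ x ∈ 𝒪[L] := by
  rw [mem_pPow, le_ord_iff, Valuation.mem_integer_iff, neg_zero, WithZero.exp_zero,
    ← map_one (IsNonarchimedeanLocalField.valueGroupWithZeroIsoInt L)]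
  exact map_le_map_iff (IsNonarchimedeanLocalField.valueGroupWithZeroIsoInt L)

lemma residue_eq_zero_iff {x : 𝒪[L]} : IsLocalRing.residue 𝒪[L] x = 0 ↔ (x : L) ∈ pPow L 1 := by
  rw [IsLocalRing.residue_eq_zero_iff, IsLocalRing.mem_maximalIdeal, mem_nonunits_iff, not_iff_comm]
  constructor
  · intro h
    have h0 : ord L (x : L) = (0 : ℤ) := ord_eq_iff.2 ⟨mem_pPow_zero_iff.2 x.2, h⟩
    refine IsUnit.of_mul_eq_one ⟨(x : L)⁻¹, ?_⟩ (Subtype.ext (mul_inv_cancel₀ (ne_zero_of_ord h0)))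
    exact mem_pPow_zero_iff.1 (mem_pPow_of_ord (ord_inv_of h0 (by omega)))
  · rintro ⟨y, rfl⟩ h
    have h1 : ((y : 𝒪[L]) : L) * ((y⁻¹ : 𝒪[L]ˣ) : 𝒪[L]) ∈ pPow L 1 :=
      mul_mem_pPow h (mem_pPow_zero_iff.2 ((y⁻¹ : 𝒪[L]ˣ) : 𝒪[L]).2) (by omega)
    rw [← Subring.coe_mul, Units.mul_inv, Subring.coe_one, mem_pPow, ord_one,
      ← WithTop.coe_zero, WithTop.coe_le_coe] at h1
    omega

/-- Dividing by `p ^ i` and reducing gives a surjection from `𝔭^i` onto the residue field, with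
kernel `𝔭^(i+1)`. -/
lemma relIndex_pPow_succ {p : L} (hp : ord L p = (1 : ℤ)) (i : ℤ) :
    (pPow L (i + 1)).relIndex (pPow L i) = residueCard L := by
  have hmem : ∀ x : pPow L i, (x : L) * p ^ (-i) ∈ 𝒪[L] := fun x =>
    mem_pPow_zero_iff.1 (mul_mem_pPow x.2 (mem_pPow_of_ord (ord_zpow hp (-i))) (by omega))
  let f : pPow L i →+ 𝓀[L] := (IsLocalRing.residue 𝒪[L]).toAddMonoidHom.comp
    { toFun := fun x => ⟨(x : L) * p ^ (-i), hmem x⟩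
      map_zero' := by simp
      map_add' := fun x y => by simp [add_mul] }
  have hp0 := ne_zero_of_ord hp
  have hker : f.ker = (pPow L (i + 1)).addSubgroupOf (pPow L i) := by
    ext x
    rw [AddMonoidHom.mem_ker, AddSubgroup.mem_addSubgroupOf]
    change IsLocalRing.residue 𝒪[L] ⟨(x : L) * p ^ (-i), hmem x⟩ = 0 ↔ _
    rw [residue_eq_zero_iff]
    constructor
    · intro h
      have := mul_mem_pPow h (mem_pPow_of_ord (ord_zpow hp i)) (k := i + 1) (by omega)
      rwa [mul_assoc, ← zpow_add₀ hp0, neg_add_cancel, zpow_zero, mul_one] at this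
    · exact fun h => mul_mem_pPow h (mem_pPow_of_ord (ord_zpow hp (-i))) (by omega)
  have hsurj : Function.Surjective f := by
    intro y
    obtain ⟨z, rfl⟩ := IsLocalRing.residue_surjective y
    refine ⟨⟨(z : L) * p ^ i, mul_mem_pPow (mem_pPow_zero_iff.2 z.2)
      (mem_pPow_of_ord (ord_zpow hp i)) (by omega)⟩, ?_⟩
    change IsLocalRing.residue 𝒪[L] ⟨(z : L) * p ^ i * p ^ (-i), _⟩ = _
    congr 1
    ext
    simp only
    rw [mul_assoc, ← zpow_add₀ hp0, add_neg_cancel, zpow_zero, mul_one]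
  rw [AddSubgroup.relIndex, ← hker, AddSubgroup.index_ker, AddMonoidHom.range_eq_top.2 hsurj,
    AddSubgroup.card_top]
  rfl

lemma relIndex_pPow {p : L} (hp : ord L p = (1 : ℤ)) (i : ℤ) (k : ℕ) :
    (pPow L (i + k)).relIndex (pPow L i) = residueCard L ^ k := by
  induction k with
  | zero => simp
  | succ k ih =>
    rw [← AddSubgroup.relIndex_mul_relIndex _ (pPow L (i + k)), ih, pow_succ', Nat.cast_succ,
      ← add_assoc, relIndex_pPow_succ hp]
    · exact fun x hx => pPow_mono (by omega) hx
    · exact fun x hx => pPow_mono (by omega) hx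

/-- The quotient `𝔭^i / 𝔭^j`. -/
abbrev PQuot (L : Type*) [Field L] [ValuativeRel L] [TopologicalSpace L]
    [IsNonarchimedeanLocalField L] (i j : ℤ) : Type _ :=
  pPow L i ⧸ (pPow L j).addSubgroupOf (pPow L i)

lemma card_pQuot {p : L} (hp : ord L p = (1 : ℤ)) {i j : ℤ} {k : ℕ} (h : j = i + k) :
    Nat.card (PQuot L i j) = residueCard L ^ k := by
  subst h
  exact relIndex_pPow hp i k

lemma residueCard_pos : 0 < residueCard L := Nat.card_pos

lemma finite_pQuot {p : L} (hp : ord L p = (1 : ℤ)) {i j : ℤ} {k : ℕ} (h : j = i + k) :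
    Finite (PQuot L i j) :=
  Nat.finite_of_card_ne_zero (by rw [card_pQuot hp h]; exact (pow_pos residueCard_pos _).ne')

variable (L) in
/-- The subgroup `𝔭 / 𝔭^j` of `O / 𝔭^j`. -/
def pQuotOne (j : ℤ) : AddSubgroup (PQuot L 0 j) :=
  ((pPow L 1).addSubgroupOf (pPow L 0)).map (QuotientAddGroup.mk' _)

lemma mk_mem_pQuotOne {j : ℤ} (hj : 1 ≤ j) (x : pPow L 0) :
    (QuotientAddGroup.mk x : PQuot L 0 j) ∈ pQuotOne L j ↔ (x : L) ∈ pPow L 1 := by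
  constructor
  · rintro ⟨y, hy, h⟩
    have := pPow_mono hj (AddSubgroup.mem_addSubgroupOf.1 (QuotientAddGroup.eq.1 h))
    have h' := add_mem (AddSubgroup.mem_addSubgroupOf.1 hy) this
    simpa using h'
  · exact fun h => ⟨x, h, rfl⟩

/-- The subgroup pulls back to `𝔭` in `O`, so its index is `q`; divide the order `q^k` of `O / 𝔭^k`
by it. -/
lemma card_pQuotOne {p : L} (hp : ord L p = (1 : ℤ)) {k : ℕ} (hk : 1 ≤ k) :
    Nat.card (pQuotOne L (k : ℤ)) = residueCard L ^ (k - 1) := by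
  have hidx : (pQuotOne L (k : ℤ)).index = residueCard L := by
    have hs := AddSubgroup.index_comap_of_surjective (pQuotOne L (k : ℤ))
      (QuotientAddGroup.mk'_surjective ((pPow L (k : ℤ)).addSubgroupOf (pPow L 0)))
    rw [← hs, ← relIndex_pPow_succ hp 0, AddSubgroup.relIndex]
    congr 1
    ext x
    exact mk_mem_pQuotOne (by omega) x
  have h := AddSubgroup.card_mul_index (pQuotOne L (k : ℤ))
  rw [hidx, card_pQuot hp (k := k) (by omega)] at h
  refine Nat.eq_of_mul_eq_mul_right residueCard_pos (h.trans ?_)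
  rw [← pow_succ, Nat.sub_add_cancel hk]

/-- For `j ≥ 1`, belonging to `𝔭` depends only on the class modulo `𝔭^j`, so an arbitrary lift of a
unit class is a unit. -/
lemma ord_out {j : ℤ} (hj : 1 ≤ j) (h : {h : PQuot L 0 j // h ∉ pQuotOne L j}) :
    ord L (Quotient.out h.1 : pPow L 0).1 = (0 : ℤ) := by
  refine ord_eq_iff.2 ⟨(Quotient.out h.1 : pPow L 0).2, fun hmem => h.2 ?_⟩
  rw [← QuotientAddGroup.out_eq' h.1]
  exact (mk_mem_pQuotOne hj _).2 hmem

end Quotients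

/-! ### Explicit solutions of `g⁻¹ τ(g) = ẇ` and their cosets modulo `E^× I_E`. -/

section Matrices

variable {F E : Type*} [Field F] [ValuativeRel F] [TopologicalSpace F]
  [IsNonarchimedeanLocalField F] [Field E] [ValuativeRel E] [TopologicalSpace E]
  [IsNonarchimedeanLocalField E] [Algebra F E] {d : ℕ}

lemma ord_pow {L : Type*} [Field L] [ValuativeRel L] [TopologicalSpace L]
    [IsNonarchimedeanLocalField L] {x : L} (hx : ord L x = (1 : ℤ)) (k : ℕ) :
    ord L (x ^ k) = ((k : ℤ) : WithTop ℤ) := by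
  rw [← zpow_natCast]
  exact ord_zpow hx k

lemma ord_inv_pow {L : Type*} [Field L] [ValuativeRel L] [TopologicalSpace L]
    [IsNonarchimedeanLocalField L] {x : L} (hx : ord L x = (1 : ℤ)) (k : ℕ) :
    ord L (x ^ k)⁻¹ = ((-(k : ℤ) : ℤ) : WithTop ℤ) :=
  ord_inv_of (ord_pow hx k) rfl

/-- Elements of `I_L` which are congruent modulo the lattice lie in the same left coset of the level
subgroup. -/
lemma inv_mul_mem_levelSubgroup {L : Type*} [Field L] [ValuativeRel L] [TopologicalSpace L]
    [IsNonarchimedeanLocalField L] {k : ℕ} {g h : GL (Fin 2) L} (hg : g ∈ iwahori L)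
    (hh : h ∈ iwahori L) (hgh : InLattice k (h.val - g.val)) : g⁻¹ * h ∈ levelSubgroup L k := by
  refine ⟨mul_mem (inv_mem hg) hh, ?_⟩
  have : (g⁻¹ * h).val - 1 = g⁻¹.val * (h.val - g.val) := by
    rw [mul_sub, Units.inv_mul, Units.val_mul]
  rw [this]
  exact InLattice.mul_left (inLattice_of_mem_iwahori (inv_mem hg)) hgh

lemma centerIwahori_cases {g : GL (Fin 2) E} (hg : g ∈ centerIwahori E) :
    ∃ z : E, ∃ i ∈ iwahori E, g.val = z • i.val := by
  obtain ⟨c, hc, i, hi, rfl⟩ := Subgroup.mem_sup_of_normal_left.1 hg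
  obtain ⟨z, hz⟩ := Matrix.GeneralLinearGroup.mem_center_iff_val_mem_range_scalar.1 hc
  refine ⟨z, i, hi, ?_⟩
  rw [Units.val_mul, ← hz]
  ext a b
  simp

namespace WildQuadraticData

lemma π_trace [CharP F 2] (D : WildQuadraticData F E d) :
    algebraMap F E D.Δ = D.π + D.τ D.π := by
  have : CharP E 2 := charP_of_injective_algebraMap (algebraMap F E).injective 2
  rw [D.τ_π, add_left_comm, CharTwo.add_self_eq_zero, add_zero]

lemma τπ_ne_zero [CharP F 2] (D : WildQuadraticData F E d) : D.τ D.π ≠ 0 :=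
  ne_zero_of_ord D.ord_τ_π

lemma two_half (D : WildQuadraticData F E d) : (d + 1) / 2 + (d + 1) / 2 = d + 1 := by
  obtain ⟨e, rfl⟩ := D.d_odd
  omega

/-- Elements of `F` have even valuation in `E`, which allows the slack of one: `2k ≥ j ≥ 2i - 1`
forces `k ≥ i`. -/
lemma mem_pPow_of_algebraMap (D : WildQuadraticData F E d) {x : F} {i j : ℤ}
    (h : algebraMap F E x ∈ pPow E j) (hij : i + i ≤ j + 1) : x ∈ pPow F i := by
  by_cases hx : x = 0
  · simp [hx, zero_mem]
  obtain ⟨k, hk⟩ := exists_ord hx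
  rw [mem_pPow, D.ord_algebraMap_of hk rfl, WithTop.coe_le_coe] at h
  exact pPow_mono (by omega) (mem_pPow_of_ord hk)

lemma mem_pPow_of_algebraMap_mul_π (D : WildQuadraticData F E d) {x : F} {i j : ℤ}
    (h : algebraMap F E x * D.π ∈ pPow E j) (hij : i + i ≤ j) : x ∈ pPow F i := by
  have := mul_mem_pPow h (mem_pPow_of_ord (ord_inv_of D.ord_π' rfl)) (k := j - 1) (by omega)
  rw [mul_inv_cancel_right₀ D.π_ne_zero] at this
  exact D.mem_pPow_of_algebraMap this (by omega)

/-- The powers of `ε = τ(π)/π` replace some of the factors `π` by `τ(π)`, so that the entries of ẇ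
become monomials in `π` and `τ(π)`. -/
lemma wDot_val [CharP F 2] (D : WildQuadraticData F E d) (n : ℕ) : (D.wDot n).val =
    !![0, (D.π ^ (n / 2) * D.τ D.π ^ ((n + 1) / 2))⁻¹;
      D.π ^ ((n + 1) / 2) * D.τ D.π ^ (n / 2), 0] := by
  have h1 := D.π_ne_zero
  have h2 := D.τπ_ne_zero
  have hn : D.π ^ n = D.π ^ (n / 2) * D.π ^ ((n + 1) / 2) := by
    rw [← pow_add]
    congr 1
    omega
  ext i j
  fin_cases i <;> fin_cases j <;>
    simp [wDot, antidiag, diag, ε, τU, πU, mul_pow, hn] <;> field_simp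

/-- For `a = x + yπ` the term `x` cancels in characteristic two, leaving `a + τ(a) = yΔ`; valuation
one of `a` forces `y` to be a unit. -/
lemma ord_add_τ [CharP F 2] (D : WildQuadraticData F E d) {a : E} (ha : ord E a = (1 : ℤ)) :
    ord E (a + D.τ a) = ((d + 1 : ℤ) : WithTop ℤ) := by
  have : CharP E 2 := charP_of_injective_algebraMap (algebraMap F E).injective 2
  obtain ⟨x, y, rfl⟩ := D.exists_coords a
  obtain ⟨hx, hy⟩ := D.coords_mem (mem_pPow_of_ord ha)
  have hx' := D.mem_pPow_of_algebraMap hx (i := 1) (by omega)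
  have hy1 : ord E (algebraMap F E y * D.π) = (1 : ℤ) := by
    rw [← add_sub_cancel_left (algebraMap F E x) (algebraMap F E y * D.π), sub_eq_neg_add, add_comm]
    exact ord_add_of ha (neg_mem (D.algebraMap_mem_pPow hx' (by omega)))
  have hy0 : ord E (algebraMap F E y) = (0 : ℤ) := by
    have := ord_mul_of hy1 (ord_inv_of D.ord_π' rfl) (k := 0) (by omega)
    rwa [mul_inv_cancel_right₀ D.π_ne_zero] at this
  have e : algebraMap F E x + algebraMap F E y * D.π + D.τ (algebraMap F E x +
      algebraMap F E y * D.π) = algebraMap F E y * algebraMap F E D.Δ := by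
    rw [map_add, map_mul, AlgEquiv.commutes, AlgEquiv.commutes, D.π_trace]
    linear_combination CharTwo.add_self_eq_zero (algebraMap F E x)
  rw [e]
  exact ord_mul_of hy0 D.ord_Δ' (by omega)

lemma add_τ_ne_zero [CharP F 2] (D : WildQuadraticData F E d) {a : E} (ha : ord E a = (1 : ℤ)) :
    a + D.τ a ≠ 0 :=
  ne_zero_of_ord (D.ord_add_τ ha)

/-- A matrix of the form `[[1, 1], [τ(a), a]] · e_0(x, y)` with `g⁻¹ τ(g) = ẇ`. -/
noncomputable def repMatrix (D : WildQuadraticData F E d) (n : ℕ) (a : E) :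
    Matrix (Fin 2) (Fin 2) E :=
  !![D.π ^ (n / 2) * (D.τ D.π ^ ((d + 1) / 2))⁻¹, (D.π ^ ((d + 1) / 2 + (n + 1) / 2))⁻¹;
    D.τ a * (D.π ^ (n / 2) * (D.τ D.π ^ ((d + 1) / 2))⁻¹),
      a * (D.π ^ ((d + 1) / 2 + (n + 1) / 2))⁻¹]

lemma repMatrix_det [CharP F 2] (D : WildQuadraticData F E d) (n : ℕ) {a : E}
    (ha : ord E a = (1 : ℤ)) : (D.repMatrix n a).det ≠ 0 := by
  have : CharP E 2 := charP_of_injective_algebraMap (algebraMap F E).injective 2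
  have h1 := D.π_ne_zero
  have h2 := D.τπ_ne_zero
  rw [repMatrix, Matrix.det_fin_two_of, show ∀ x y : E, x * (a * y) - y * (D.τ a * x) =
    (a - D.τ a) * (x * y) by intros; ring, CharTwo.sub_eq_add]
  have := D.add_τ_ne_zero ha
  positivity

/-- The representative `[[1, 1], [τ(a), a]] · e_0(x, y)` of `e_-(a) v̇ I_E`. -/
noncomputable def rep [CharP F 2] (D : WildQuadraticData F E d) (n : ℕ) {a : E}
    (ha : ord E a = (1 : ℤ)) : GL (Fin 2) E :=
  Matrix.GeneralLinearGroup.mkOfDetNeZero (D.repMatrix n a) (D.repMatrix_det n ha)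

lemma rep_val [CharP F 2] (D : WildQuadraticData F E d) (n : ℕ) {a : E}
    (ha : ord E a = (1 : ℤ)) : (D.rep n ha).val = D.repMatrix n a := rfl

/-- Applying τ exchanges the columns `(1, τ(a))` and `(1, a)`, so `g⁻¹ τ(g)` is antidiagonal. The
diagonal factors in `repMatrix` are tuned so that it is ẇ itself, not merely an element of `J ẇ J`.
-/
lemma τG_rep [CharP F 2] (D : WildQuadraticData F E d) (n : ℕ) {a : E}
    (ha : ord E a = (1 : ℤ)) : D.τG (D.rep n ha) = D.rep n ha * D.wDot n := by
  have h1 := D.π_ne_zero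
  have h2 := D.τπ_ne_zero
  apply Units.ext
  rw [Units.val_mul, rep_val, wDot_val]
  have : (D.τG (D.rep n ha)).val = (D.repMatrix n a).map D.τ := rfl
  rw [this]
  ext i j
  fin_cases i <;> fin_cases j <;> simp [repMatrix, D.τ_τ, pow_add] <;> field_simp

lemma vDot_inv_val (D : WildQuadraticData F E d) (n : ℕ) : ((D.vDot n)⁻¹).val =
    !![0, (D.π ^ ((d + 1) / 2 + n / 2))⁻¹; D.π ^ ((d + 1) / 2 + (n + 1) / 2), 0] := by
  change (D.vDot n).inv = _
  simp [vDot, antidiag, πU]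

lemma vDot_val (D : WildQuadraticData F E d) (n : ℕ) : (D.vDot n).val =
    !![0, (D.π ^ ((d + 1) / 2 + (n + 1) / 2))⁻¹; D.π ^ ((d + 1) / 2 + n / 2), 0] := by
  ext i j
  fin_cases i <;> fin_cases j <;> simp [vDot, antidiag, πU]

/-- Dividing `rep` by `e_-(a) v̇` leaves a lower triangular matrix. Its upper left entry is a unit
because the valuation `d + 1` of `a + τ(a)` cancels the two exponents `(d+1)/2`, and its lower left
entry has valuation `n ≥ 1`. -/
lemma rep_mem_cell [CharP F 2] (D : WildQuadraticData F E d) {n : ℕ} (hn : 1 ≤ n) {a : E}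
    (ha : ord E a = (1 : ℤ)) :
    ∃ i ∈ iwahori E, D.rep n ha = eMinus a * D.vDot n * i := by
  have : CharP E 2 := charP_of_injective_algebraMap (algebraMap F E).injective 2
  have h1 := D.π_ne_zero
  have h2 := D.τπ_ne_zero
  have hd := D.two_half
  refine ⟨(D.vDot n)⁻¹ * ((eMinus a)⁻¹ * D.rep n ha), ?_, by group⟩
  have hv : ((D.vDot n)⁻¹ * ((eMinus a)⁻¹ * D.rep n ha)).val =
      !![(D.π ^ ((d + 1) / 2 + n / 2))⁻¹ * ((a + D.τ a) *
        (D.π ^ (n / 2) * (D.τ D.π ^ ((d + 1) / 2))⁻¹)), 0;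
      D.π ^ ((d + 1) / 2 + (n + 1) / 2) * (D.π ^ (n / 2) * (D.τ D.π ^ ((d + 1) / 2))⁻¹), 1] := by
    have e1 : ((eMinus a)⁻¹ : GL (Fin 2) E).val = !![1, 0; -a, 1] := rfl
    rw [Units.val_mul, Units.val_mul, vDot_inv_val, e1, rep_val, repMatrix]
    generalize D.π ^ (n / 2) * (D.τ D.π ^ ((d + 1) / 2))⁻¹ = X
    have hY : D.π ^ ((d + 1) / 2 + (n + 1) / 2) ≠ 0 := pow_ne_zero _ h1
    generalize D.π ^ ((d + 1) / 2 + (n + 1) / 2) = Y at hY ⊢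
    ext i j
    fin_cases i <;> fin_cases j <;> simp [hY, CharTwo.neg_eq, CharTwo.add_self_eq_zero]
    exact Or.inl (by ring)
  have hX := ord_mul_of (ord_pow D.ord_π' (n / 2)) (ord_inv_pow D.ord_τ_π ((d + 1) / 2)) rfl
  refine ⟨?_, ?_, ?_, ?_⟩ <;> rw [hv]
  · exact ord_mul_of (ord_inv_pow D.ord_π' _) (ord_mul_of (D.ord_add_τ ha) hX rfl) (by omega)
  · simp [zero_mem]
  · exact pPow_mono (by omega) (mem_pPow_of_ord (ord_mul_of (ord_pow D.ord_π' _) hX rfl))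
  · simp [ord_one]

/-- Points of the Schubert cell are separated modulo `𝔭_E^(n+d+1)` by their cosets modulo
`E^× I_E`. -/
lemma cell_inv_mul_mem_iff (D : WildQuadraticData F E d) {n : ℕ} {a b : E} {i j : GL (Fin 2) E}
    (hi : i ∈ iwahori E) (hj : j ∈ iwahori E) :
    (eMinus a * D.vDot n * i)⁻¹ * (eMinus b * D.vDot n * j) ∈ centerIwahori E ↔
      b - a ∈ pPow E (n + d + 1) := by
  have h1 := D.π_ne_zero
  have hd := D.two_half
  -- Conjugation by v̇ makes `e_-(b - a)` upper unipotent; the exponent `n + d + 1` is the sum of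
  -- the two exponents occurring in v̇.
  have hval : ((D.vDot n)⁻¹ * ((eMinus a)⁻¹ * eMinus b) * D.vDot n).val =
      !![1, (b - a) * (D.π ^ (n + d + 1))⁻¹; 0, 1] := by
    have e1 : ((eMinus a)⁻¹ * eMinus b : GL (Fin 2) E).val = !![1, 0; b - a, 1] := by
      have e1 : ((eMinus a)⁻¹ : GL (Fin 2) E).val = !![1, 0; -a, 1] := rfl
      rw [Units.val_mul, e1]
      ext i j
      fin_cases i <;> fin_cases j <;> simp [eMinus]
      ring
    have hp : D.π ^ (n + d + 1) =
        D.π ^ ((d + 1) / 2 + n / 2) * D.π ^ ((d + 1) / 2 + (n + 1) / 2) := by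
      rw [← pow_add]
      congr 1
      omega
    rw [Units.val_mul, Units.val_mul, vDot_inv_val, vDot_val, e1, hp]
    have hX : D.π ^ ((d + 1) / 2 + n / 2) ≠ 0 := pow_ne_zero _ h1
    have hY : D.π ^ ((d + 1) / 2 + (n + 1) / 2) ≠ 0 := pow_ne_zero _ h1
    generalize D.π ^ ((d + 1) / 2 + (n + 1) / 2) = Y at hY ⊢
    generalize D.π ^ ((d + 1) / 2 + n / 2) = X at hX ⊢
    ext i j
    fin_cases i <;> fin_cases j <;> simp [hX, hY]
    ring
  set g := (D.vDot n)⁻¹ * ((eMinus a)⁻¹ * eMinus b) * D.vDot n with hg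
  have e : (eMinus a * D.vDot n * i)⁻¹ * (eMinus b * D.vDot n * j) = i⁻¹ * g * j := by
    rw [hg]
    group
  have hi' := iwahori_le_centerIwahori hi
  rw [e, Subgroup.mul_mem_cancel_right _ (iwahori_le_centerIwahori hj),
    Subgroup.mul_mem_cancel_left _ (inv_mem hi')]
  constructor
  · intro h
    obtain ⟨z, k, hk, hz⟩ := centerIwahori_cases h
    rw [hval] at hz
    have h00 : 1 = z * k.val 0 0 := congrFun (congrFun hz 0) 0
    have h01 : (b - a) * (D.π ^ (n + d + 1))⁻¹ = z * k.val 0 1 := congrFun (congrFun hz 0) 1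
    -- The upper left entry 1 forces the scalar to be a unit, so allowing scalars does not weaken
    -- the condition on the upper right entry.
    have hz0 : ord E z = (0 : ℤ) := by
      rw [eq_inv_of_mul_eq_one_left h00.symm]
      exact ord_inv_of hk.1 (by omega)
    have h := mul_mem_pPow (mem_pPow_of_ord hz0) hk.2.1 (k := 0) (by omega)
    rw [← h01] at h
    have := mul_mem_pPow h (mem_pPow_of_ord (ord_pow D.ord_π' (n + d + 1))) (k := n + d + 1)
      (by push_cast; omega)
    rwa [inv_mul_cancel_right₀ (pow_ne_zero _ h1)] at this
  · intro h
    refine iwahori_le_centerIwahori ⟨?_, ?_, ?_, ?_⟩ <;> rw [hval]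
    · simp [ord_one]
    · exact mul_mem_pPow h (mem_pPow_of_ord (ord_inv_pow D.ord_π' (n + d + 1)))
        (by push_cast; omega)
    · simp [zero_mem]
    · simp [ord_one]

lemma τG_mem_iwahori [CharP F 2] (D : WildQuadraticData F E d) {g : GL (Fin 2) E}
    (hg : g ∈ iwahori E) : D.τG g ∈ iwahori E :=
  ⟨D.ord_τ hg.1, D.τ_mem_pPow hg.2.1, D.τ_mem_pPow hg.2.2.1, D.ord_τ hg.2.2.2⟩

lemma τG_mem_centerIwahori [CharP F 2] (D : WildQuadraticData F E d) {g : GL (Fin 2) E}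
    (hg : g ∈ centerIwahori E) : D.τG g ∈ centerIwahori E := by
  obtain ⟨z, i, hi, h⟩ := centerIwahori_cases hg
  have hz : z ≠ 0 := by
    rintro rfl
    have := (Matrix.isUnit_iff_isUnit_det _).1 g.isUnit
    simp [h] at this
  have : g = diag (Units.mk0 z hz) (Units.mk0 z hz) * i := by
    apply Units.ext
    rw [h]
    ext a b
    fin_cases a <;> simp [diag, Matrix.mul_apply, Fin.sum_univ_two]
  rw [this, map_mul, τG_diag]
  refine mul_mem (Subgroup.mem_sup_left ?_) (iwahori_le_centerIwahori (D.τG_mem_iwahori hi))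
  exact Subgroup.mem_center_iff.2 fun g => diag_comm _ g

/-- An element of `E^× I_E` relating two points of `X_ẇ^m(1)` belongs to `Γ̃`. -/
lemma mem_rawGamma_of_mem [CharP F 2] (D : WildQuadraticData F E d) {n m : ℕ} {x γ : GL (Fin 2) E}
    (hγ : γ ∈ centerIwahori E)
    (hx : x⁻¹ * D.τG x ∈ DoubleCoset.doubleCoset (D.wDot n)
      (levelSubgroup E (2 * m + 1) : Set (GL (Fin 2) E)) (levelSubgroup E (2 * m + 1)))
    (hxγ : (x * γ)⁻¹ * D.τG (x * γ) ∈ DoubleCoset.doubleCoset (D.wDot n)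
      (levelSubgroup E (2 * m + 1) : Set (GL (Fin 2) E)) (levelSubgroup E (2 * m + 1))) :
    γ ∈ rawGamma D n m := by
  set J := levelSubgroup E (2 * m + 1)
  set y := x⁻¹ * D.τG x with hy
  -- Since `c` and `τ(c)` normalize J, τ-conjugation by `c` permutes the J-double cosets. It
  -- therefore stabilizes `J ẇ J` as soon as it sends one of its elements, here `y`, back into it.
  have key : ∀ c ∈ centerIwahori E, ∀ a b : GL (Fin 2) E,
      a ∈ DoubleCoset.doubleCoset b (J : Set (GL (Fin 2) E)) J →
      c⁻¹ * a * D.τG c ∈ DoubleCoset.doubleCoset (c⁻¹ * b * D.τG c) (J : Set (GL (Fin 2) E)) J := by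
    rintro c hc a b hab
    obtain ⟨j, hj, k, hk, rfl⟩ := DoubleCoset.mem_doubleCoset.1 hab
    have h1 := (Subgroup.mem_normalizer_iff.1
      (centerIwahori_le_normalizer (2 * m + 1) (inv_mem hc)) j).1 hj
    have h2 := (Subgroup.mem_normalizer_iff.1 (centerIwahori_le_normalizer (2 * m + 1)
      (inv_mem (D.τG_mem_centerIwahori hc))) k).1 hk
    refine DoubleCoset.mem_doubleCoset.2 ⟨_, h1, _, h2, ?_⟩
    group
  have e : (x * γ)⁻¹ * D.τG (x * γ) = γ⁻¹ * y * D.τG γ := by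
    rw [map_mul, hy]
    group
  rw [e] at hxγ
  have hsymm : ∀ a b : GL (Fin 2) E, a ∈ DoubleCoset.doubleCoset b (J : Set (GL (Fin 2) E)) J →
      b ∈ DoubleCoset.doubleCoset a (J : Set (GL (Fin 2) E)) J := fun a b h => by
    rw [DoubleCoset.doubleCoset_eq_of_mem h]
    exact DoubleCoset.mem_doubleCoset_self J J b
  have htrans : ∀ a b c : GL (Fin 2) E, a ∈ DoubleCoset.doubleCoset b (J : Set (GL (Fin 2) E)) J →
      b ∈ DoubleCoset.doubleCoset c (J : Set (GL (Fin 2) E)) J →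
      a ∈ DoubleCoset.doubleCoset c (J : Set (GL (Fin 2) E)) J := fun a b c h h' => by
    rwa [DoubleCoset.doubleCoset_eq_of_mem h'] at h
  refine ⟨hγ, fun z => ⟨fun h => ?_, fun h => ?_⟩⟩
  · have h' := htrans _ _ _ h (hsymm _ _ hxγ)
    have := key γ⁻¹ (inv_mem hγ) _ _ h'
    simp only [inv_inv, map_inv, mul_assoc, mul_inv_cancel_left, mul_inv_cancel, mul_one] at this
    exact htrans _ _ _ this hx
  · exact htrans _ _ _ (key γ hγ z y (htrans _ _ _ h (hsymm _ _ hx))) hxγ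

end WildQuadraticData

end Matrices

/-! ### Unipotent elements of Γ̃ and the values of its characters on them. -/

section Characters

variable {F E : Type*} [Field F] [ValuativeRel F] [TopologicalSpace F]
  [IsNonarchimedeanLocalField F] [Field E] [ValuativeRel E] [TopologicalSpace E]
  [IsNonarchimedeanLocalField E] [Algebra F E] {d : ℕ}

namespace WildQuadraticData

/-- Matrices `[[α, β], [ϖ^n τ(β), τ(α)]]` in `I_E` commute with `ẇ` up to `τ`. -/
lemma mem_rawGamma_of_val [CharP F 2] (D : WildQuadraticData F E d) {n m : ℕ} (hn : 1 ≤ n)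
    {g : GL (Fin 2) E} {α β : E} (hα : ord E α = (0 : ℤ)) (hβ : β ∈ pPow E 0)
    (hg : g.val = !![α, β; (D.π * D.τ D.π) ^ n * D.τ β, D.τ α]) :
    g ∈ rawGamma D n m ∧ g ∈ iwahori E := by
  have h1 := D.π_ne_zero
  have h2 := D.τπ_ne_zero
  have hI : g ∈ iwahori E := by
    refine ⟨?_, ?_, ?_, ?_⟩ <;> rw [hg]
    · exact hα
    · exact hβ
    · have h3 : ord E ((D.π * D.τ D.π) ^ n) = ((n + n : ℤ) : WithTop ℤ) := by
        rw [mul_pow]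
        exact ord_mul_of (ord_pow D.ord_π' n) (ord_pow D.ord_τ_π n) rfl
      exact mul_mem_pPow (mem_pPow_of_ord h3) (D.τ_mem_pPow hβ) (by omega)
    · exact D.ord_τ hα
  -- What remains is `ẇ τ(g) = g ẇ`: conjugation by ẇ swaps the diagonal entries, and it swaps the
  -- off-diagonal ones up to the factors `(π τ(π))^(±n)`.
  refine ⟨mem_rawGamma D (iwahori_le_centerIwahori hI)
    (iwahori_le_centerIwahori (D.τG_mem_iwahori hI)) ?_, hI⟩
  apply Units.ext
  have hτ : (D.τG g).val = g.val.map D.τ := rfl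
  have hpow : ∀ x : E, x ^ n = x ^ (n / 2) * x ^ ((n + 1) / 2) := by
    intro x
    rw [← pow_add]
    congr 1
    omega
  rw [Units.val_mul, Units.val_mul, wDot_val, hτ, hg]
  ext i j
  fin_cases i <;> fin_cases j <;>
    simp [Matrix.mul_apply, Fin.sum_univ_two, D.τ_τ, mul_pow, hpow D.π, hpow (D.τ D.π)] <;>
    field_simp

/-- The ratio of the entries of the diagonal part of `rep`. -/
noncomputable def ratio (D : WildQuadraticData F E d) (n : ℕ) : E :=
  D.τ D.π ^ ((d + 1) / 2) * (D.π ^ ((d + 1) / 2 + n))⁻¹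

lemma ord_ratio [CharP F 2] (D : WildQuadraticData F E d) (n : ℕ) :
    ord E (D.ratio n) = ((-n : ℤ) : WithTop ℤ) :=
  ord_mul_of (ord_pow D.ord_τ_π _) (ord_inv_pow D.ord_π' _) (by push_cast; omega)

lemma ratio_ne_zero [CharP F 2] (D : WildQuadraticData F E d) (n : ℕ) : D.ratio n ≠ 0 :=
  ne_zero_of_ord (D.ord_ratio n)

/-- This identity gives `unip` with parameter in `F` the shape `[[α, β], [ϖ^n τ(β), τ(α)]]` required
for membership in Γ̃. -/
lemma ratio_inv [CharP F 2] (D : WildQuadraticData F E d) (n : ℕ) :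
    (D.ratio n)⁻¹ = (D.π * D.τ D.π) ^ n * D.τ (D.ratio n) := by
  have h1 := D.π_ne_zero
  have h2 := D.τπ_ne_zero
  simp only [ratio, map_mul, map_pow, map_inv₀, D.τ_τ]
  rw [mul_pow, pow_add, pow_add]
  field_simp

/-- The unipotent matrix `1 + w [[1, B], [B⁻¹, 1]]`, in characteristic two. -/
noncomputable def unip [CharP F 2] (D : WildQuadraticData F E d) (n : ℕ) (w : E) :
    GL (Fin 2) E :=
  have : CharP E 2 := charP_of_injective_algebraMap (algebraMap F E).injective 2
  have hB := D.ratio_ne_zero n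
  -- The matrix is `1 + wN` with `N = [[1, B], [B⁻¹, 1]]` and `N² = 2N = 0`, hence an involution.
  have h : !![1 + w, w * D.ratio n; w * (D.ratio n)⁻¹, 1 + w] *
      !![1 + w, w * D.ratio n; w * (D.ratio n)⁻¹, 1 + w] = 1 := by
    have h2 : (2 : E) = 0 := CharTwo.two_eq_zero
    generalize D.ratio n = B at hB ⊢
    rw [Matrix.one_fin_two]
    ext i j
    fin_cases i <;> fin_cases j <;> simp <;> field_simp
    · linear_combination (w + w ^ 2) * h2
    · linear_combination w * B * (1 + w) * h2
    · linear_combination w * (1 + w) * h2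
    · linear_combination (w + w ^ 2) * h2
  { val := !![1 + w, w * D.ratio n; w * (D.ratio n)⁻¹, 1 + w]
    inv := !![1 + w, w * D.ratio n; w * (D.ratio n)⁻¹, 1 + w]
    val_inv := h
    inv_val := h }

lemma unip_val [CharP F 2] (D : WildQuadraticData F E d) (n : ℕ) (w : E) :
    (D.unip n w).val = !![1 + w, w * D.ratio n; w * (D.ratio n)⁻¹, 1 + w] := rfl

lemma unip_inv [CharP F 2] (D : WildQuadraticData F E d) (n : ℕ) (w : E) :
    (D.unip n w)⁻¹ = D.unip n w := rfl

/-- In `(1 + wN)(1 + w'N)` the cross term vanishes because `N² = 2N = 0`. -/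
lemma unip_add [CharP F 2] (D : WildQuadraticData F E d) (n : ℕ) (w w' : E) :
    D.unip n (w + w') = D.unip n w * D.unip n w' := by
  have : CharP E 2 := charP_of_injective_algebraMap (algebraMap F E).injective 2
  have h2 : (2 : E) = 0 := CharTwo.two_eq_zero
  have hB := D.ratio_ne_zero n
  apply Units.ext
  rw [Units.val_mul]
  simp only [unip_val]
  generalize D.ratio n = B at hB ⊢
  ext i j
  fin_cases i <;> fin_cases j <;> simp <;> field_simp
  · linear_combination -w * w' * h2
  · linear_combination -w * w' * h2
  · linear_combination -w * w' * h2
  · linear_combination -w * w' * h2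

/-- Left multiplication by `e_-(u)` on the representative of `e_-(a) v̇ I_E`. -/
lemma eMinus_mul_rep [CharP F 2] (D : WildQuadraticData F E d) (n : ℕ) {a : E}
    (ha : ord E a = (1 : ℤ)) (u : E) :
    eMinus u * D.rep n ha = D.rep n ha * D.unip n (u / (a + D.τ a)) := by
  have : CharP E 2 := charP_of_injective_algebraMap (algebraMap F E).injective 2
  have h1 := D.π_ne_zero
  have h2 := D.τπ_ne_zero
  have h3 := D.add_τ_ne_zero ha
  apply Units.ext
  rw [Units.val_mul, Units.val_mul, unip_val, rep_val, repMatrix]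
  -- The diagonal part of `rep` has entries with quotient `ratio`, and conjugating by it turns `1 +
  -- w[[1, 1], [1, 1]]` into `unip`. Without the diagonal part, the claim is that `[[1, 1], [τ(a),
  -- a]]` sends `[[1, 1], [1, 1]]` to `(a + τ(a)) [[0, 0], [1, 1]]`.
  have hr : D.ratio n * (D.π ^ (n / 2) * (D.τ D.π ^ ((d + 1) / 2))⁻¹) =
      (D.π ^ ((d + 1) / 2 + (n + 1) / 2))⁻¹ := by
    have hn : D.π ^ n = D.π ^ (n / 2) * D.π ^ ((n + 1) / 2) := by
      rw [← pow_add]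
      congr 1
      omega
    rw [ratio, pow_add, pow_add, hn]
    field_simp
  have hB := D.ratio_ne_zero n
  rw [← hr]
  have hX : D.π ^ (n / 2) * (D.τ D.π ^ ((d + 1) / 2))⁻¹ ≠ 0 := by positivity
  generalize D.π ^ (n / 2) * (D.τ D.π ^ ((d + 1) / 2))⁻¹ = X at hX ⊢
  generalize D.ratio n = B at hB ⊢
  generalize D.τ a = b at h3 ⊢
  have h2 : (2 : E) = 0 := CharTwo.two_eq_zero
  ext i j
  fin_cases i <;> fin_cases j <;> simp [eMinus] <;> field_simp
  · linear_combination -u * h2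
  · linear_combination -u * h2
  · ring
  · ring

lemma algebraMap_mem_of_half (D : WildQuadraticData F E d) {n : ℕ} {w : F}
    (hw : w ∈ pPow F ((n + 1) / 2 : ℕ)) : algebraMap F E w ∈ pPow E n :=
  D.algebraMap_mem_pPow hw (by omega)

/-- As `ratio` has valuation `-n`, integrality needs `w` of valuation at least `n` in `E`; for `w ∈
F` this is `ord_F w ≥ ⌈n/2⌉`, written `(n + 1) / 2`. -/
lemma unip_mem [CharP F 2] (D : WildQuadraticData F E d) {n : ℕ} (m : ℕ) (hn : 1 ≤ n) {w : F}
    (hw : w ∈ pPow F ((n + 1) / 2 : ℕ)) :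
    D.unip n (algebraMap F E w) ∈ rawGamma D n m ∧
      D.unip n (algebraMap F E w) ∈ iwahori E := by
  have hw' := D.algebraMap_mem_of_half hw
  refine D.mem_rawGamma_of_val hn (α := 1 + algebraMap F E w)
    (β := algebraMap F E w * D.ratio n) ?_ ?_ ?_
  · exact ord_add_of ord_one (pPow_mono (by omega) hw')
  · exact mul_mem_pPow hw' (mem_pPow_of_ord (D.ord_ratio n)) (by omega)
  · rw [unip_val, ratio_inv]
    simp only [map_add, map_mul, map_one, AlgEquiv.commutes]
    rw [mul_left_comm]

/-- The homomorphism from a fractional ideal of `F` to `Γ̃` given by unipotent matrices. -/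
noncomputable def unipHom [CharP F 2] (D : WildQuadraticData F E d) {n : ℕ} (m : ℕ) (hn : 1 ≤ n) :
    Multiplicative (pPow F ((n + 1) / 2 : ℕ)) →* GammaTilde D n m :=
  (toGammaTilde D n m).comp
    { toFun := fun w => ⟨D.unip n (algebraMap F E w.toAdd), (D.unip_mem m hn w.toAdd.2).1⟩
      map_one' := by
        ext1
        apply Units.ext
        simp [unip_val, Matrix.one_fin_two]
      map_mul' := fun w w' => by
        ext1
        simp [unip_add] }

lemma unipHom_apply [CharP F 2] (D : WildQuadraticData F E d) {n : ℕ} (m : ℕ) (hn : 1 ≤ n)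
    (w : pPow F ((n + 1) / 2 : ℕ)) :
    D.unipHom m hn (Multiplicative.ofAdd w) =
      toGammaTilde D n m ⟨D.unip n (algebraMap F E w), (D.unip_mem m hn w.2).1⟩ := rfl

lemma toGammaTilde_eq [CharP F 2] (D : WildQuadraticData F E d) {n m : ℕ} {g h : rawGamma D n m}
    (hg : g.1 ∈ iwahori E) (hh : h.1 ∈ iwahori E)
    (hgh : InLattice (2 * m + 1) (h.1.val - g.1.val)) :
    toGammaTilde D n m g = toGammaTilde D n m h :=
  QuotientGroup.eq.2 (inv_mul_mem_levelSubgroup hg hh hgh)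

lemma inLattice_of_mem {k m : ℕ} (h : k = 2 * m + 1) {M : Matrix (Fin 2) (Fin 2) E}
    (hM : ∀ i j, M i j ∈ pPow E (m + 1)) : InLattice k M := by
  subst h
  refine ⟨pPow_mono ?_ (hM 0 0), pPow_mono ?_ (hM 0 1), pPow_mono ?_ (hM 1 0),
    pPow_mono ?_ (hM 1 1)⟩ <;> omega

/-- The matrix `[[1, β], [ϖ^n τ(β), 1]]` lies in `I_E` and in the preimage of `Γ̃`. -/
lemma exists_off [CharP F 2] (D : WildQuadraticData F E d) {n : ℕ} (m : ℕ) (hn : 1 ≤ n) {β : E}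
    (hβ : β ∈ pPow E 0) : ∃ g : rawGamma D n m, g.1 ∈ iwahori E ∧
      g.1.val = !![1, β; (D.π * D.τ D.π) ^ n * D.τ β, 1] := by
  have hdet : (!![1, β; (D.π * D.τ D.π) ^ n * D.τ β, 1] : Matrix (Fin 2) (Fin 2) E).det ≠ 0 := by
    have h3 : ord E ((D.π * D.τ D.π) ^ n) = ((n + n : ℤ) : WithTop ℤ) := by
      rw [mul_pow]
      exact ord_mul_of (ord_pow D.ord_π' n) (ord_pow D.ord_τ_π n) rfl
    rw [Matrix.det_fin_two_of, mul_one, sub_eq_add_neg]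
    refine ne_zero_of_ord (j := 0) (ord_add_of ord_one (neg_mem ?_))
    exact mul_mem_pPow hβ (mul_mem_pPow (mem_pPow_of_ord h3) (D.τ_mem_pPow hβ) le_rfl) (by omega)
  have := D.mem_rawGamma_of_val (m := m) hn (g := Matrix.GeneralLinearGroup.mkOfDetNeZero _ hdet)
    (α := 1) ord_one hβ (by rw [map_one]; rfl)
  exact ⟨⟨_, this.1⟩, this.2, rfl⟩

/-- The wild ramification enters through `π + τ(π) = Δ`, of valuation `d + 1`. The resulting `d` is
the loss of valuation when the commutator equation of `char_off` is solved. -/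
lemma ord_one_add_div_τ [CharP F 2] (D : WildQuadraticData F E d) :
    ord E (1 + D.π / D.τ D.π) = (d : ℤ) := by
  have h2 := D.τπ_ne_zero
  have h : 1 + D.π / D.τ D.π = (D.π + D.τ D.π) * (D.τ D.π)⁻¹ := by
    field_simp
    ring
  rw [h]
  exact ord_mul_of (D.ord_add_τ D.ord_π') (ord_inv_of D.ord_τ_π rfl) (by omega)

/-- A character of `Γ̃` is trivial on `[[1, β], [ϖ^n τ(β), 1]]` if `β` is sufficiently small, as
this matrix is a commutator with `e_0(π, τ(π))`. -/
lemma char_off [CharP F 2] (D : WildQuadraticData F E d) {n m : ℕ} (hm : m + 1 = 2 * n + d)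
    (hn : 1 ≤ n) {K : Type*} [Field K] (χ : GammaTilde D n m →* Kˣ) {β : E}
    (hβ : β ∈ pPow E (n + d - 1)) {g : rawGamma D n m} (hgI : g.1 ∈ iwahori E)
    (hg : g.1.val = !![1, β; (D.π * D.τ D.π) ^ n * D.τ β, 1]) : χ (toGammaTilde D n m g) = 1 := by
  have : CharP E 2 := charP_of_injective_algebraMap (algebraMap F E).injective 2
  have c2 : (2 : E) = 0 := CharTwo.two_eq_zero
  have h1 := D.π_ne_zero
  have h2 := D.τπ_ne_zero
  have hε := D.ord_one_add_div_τ
  have hε0 := ne_zero_of_ord hε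
  -- Conjugation by `diag(π, τ(π))` multiplies an upper right entry by `π/τ(π)`, so `η` solves `β =
  -- η + η π/τ(π)`. The division costs `d`, leaving `η ∈ 𝔭^(n-1)`, still integral.
  set η : E := β * (1 + D.π / D.τ D.π)⁻¹ with hη
  have hη1 : η ∈ pPow E (n - 1) :=
    mul_mem_pPow hβ (mem_pPow_of_ord (ord_inv_of hε rfl)) (by omega)
  have hη0 : η ∈ pPow E 0 := pPow_mono (by omega) hη1
  have hβη : β = η + η * (D.π / D.τ D.π) := by
    have : η * (1 + D.π / D.τ D.π) = β := inv_mul_cancel_right₀ hε0 β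
    linear_combination -this
  have hq : ord E (D.π / D.τ D.π) = (0 : ℤ) := by
    rw [div_eq_mul_inv]
    exact ord_mul_of D.ord_π' (ord_inv_of D.ord_τ_π rfl) (by omega)
  obtain ⟨s, hsI, hs⟩ := D.exists_off m hn hη0
  obtain ⟨t, htI, ht⟩ := D.exists_off m hn
    (mul_mem_pPow hη0 (mem_pPow_of_ord hq) (k := 0) (by omega))
  have hP : ord E ((D.π * D.τ D.π) ^ n) = ((n + n : ℤ) : WithTop ℤ) := by
    rw [mul_pow]
    exact ord_mul_of (ord_pow D.ord_π' n) (ord_pow D.ord_τ_π n) rfl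
  have hP' := mem_pPow_of_ord hP
  set p : rawGamma D n m := ⟨diag D.πU (D.τU D.πU), diag_mem_rawGamma D n m D.πU⟩ with hp
  have hconj : p * s = t * p := by
    apply Subtype.ext
    apply Units.ext
    rw [Subgroup.coe_mul, Subgroup.coe_mul, Units.val_mul, Units.val_mul, hs, ht]
    ext i j
    fin_cases i <;> fin_cases j <;>
      simp [hp, diag, τU, πU, D.τ_τ] <;> field_simp
  -- Off the diagonal, `β + η = η π/τ(π)` in characteristic two. The diagonal errors have valuation
  -- at least `4n + d - 2 ≥ m + 1`, so they disappear modulo J.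
  have hprod : toGammaTilde D n m (g * s) = toGammaTilde D n m t := by
    refine D.toGammaTilde_eq (mul_mem hgI hsI) htI (inLattice_of_mem rfl ?_)
    rw [Subgroup.coe_mul, Units.val_mul, hg, hs, ht]
    generalize (D.π * D.τ D.π) ^ n = P at hP' ⊢
    have e : !![1, η * (D.π / D.τ D.π); P * D.τ (η * (D.π / D.τ D.π)), 1] -
        !![1, β; P * D.τ β, 1] * !![1, η; P * D.τ η, 1] =
        !![-(β * (P * D.τ η)), 0; 0, -(P * D.τ β * η)] := by
      rw [hβη]
      ext i j
      fin_cases i <;> fin_cases j <;> simp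
      · linear_combination -η * c2
      · linear_combination -P * D.τ η * c2
    rw [e]
    have k1 : β * (P * D.τ η) ∈ pPow E (m + 1) :=
      mul_mem_pPow hβ (mul_mem_pPow hP' (D.τ_mem_pPow hη1) le_rfl) (by omega)
    have k2 : P * D.τ β * η ∈ pPow E (m + 1) :=
      mul_mem_pPow (mul_mem_pPow hP' (D.τ_mem_pPow hβ) le_rfl) hη1 (by omega)
    intro i j
    fin_cases i <;> fin_cases j
    · exact neg_mem k1
    · exact zero_mem _
    · exact zero_mem _
    · exact neg_mem k2
  -- The target of `χ` is commutative, so conjugacy gives `χ(s) = χ(t)`, and `g s ≡ t` then gives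
  -- `χ(g) = 1`.
  have hc := congrArg (fun x => χ (toGammaTilde D n m x)) hconj
  have hd := congrArg χ hprod
  simp only [map_mul] at hc hd
  rw [mul_comm, mul_right_cancel_iff] at hc
  rwa [hc, mul_eq_right] at hd

/-- The value of an extension of `θ` to `Γ̃` on small unipotent matrices. -/
lemma char_unip [CharP F 2] (D : WildQuadraticData F E d) {n m : ℕ} (hm : m + 1 = 2 * n + d)
    (hn : 1 ≤ n) {K : Type*} [Field K] (χ : GammaTilde D n m →* Kˣ)
    (w : pPow F ((n + 1) / 2 : ℕ)) (hw : algebraMap F E (w : F) ∈ pPow E m) {t : Eˣ}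
    (ht : (t : E) = 1 + algebraMap F E (w : F)) :
    χ (D.unipHom m hn (Multiplicative.ofAdd w)) = χ (torusHom D n m t) := by
  obtain ⟨hΓ, hI⟩ := D.unip_mem m hn w.2
  have hd := D.d_pos
  have ht0 : ord E (t : E) = (0 : ℤ) := by
    rw [ht]
    exact ord_add_of ord_one (pPow_mono (by omega) hw)
  have hti := ord_inv_of ht0 (k := 0) (by omega)
  -- Taking out the scalar `t = 1 + w` leaves 1 on the diagonal and `β` in the upper right corner.
  -- Its valuation is at least `m - n = n + d - 1`, the exact bound of `char_off`.
  set β : E := algebraMap F E (w : F) * D.ratio n * (t : E)⁻¹ with hβ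
  have hβm : β ∈ pPow E (n + d - 1) :=
    mul_mem_pPow (mul_mem_pPow hw (mem_pPow_of_ord (D.ord_ratio n)) le_rfl)
      (mem_pPow_of_ord hti) (by omega)
  obtain ⟨s, hsI, hs⟩ := D.exists_off m hn (pPow_mono (i := 0) (by omega) hβm)
  have hτt : D.τ (t : E) = t := by
    rw [ht, map_add, map_one, AlgEquiv.commutes]
  have hprod : (⟨D.unip n (algebraMap F E (w : F)), hΓ⟩ : rawGamma D n m) =
      ⟨diag t (D.τU t), diag_mem_rawGamma D n m t⟩ * s := by
    apply Subtype.ext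
    apply Units.ext
    rw [Subgroup.coe_mul, Units.val_mul, hs, unip_val, ratio_inv]
    have ht1 : (t : E) ≠ 0 := t.ne_zero
    ext i j
    fin_cases i <;> fin_cases j <;>
      simp [diag, τU, hτt, hβ] <;> first | exact ht.symm | field_simp
  rw [unipHom_apply, hprod, map_mul, map_mul, D.char_off hm hn χ hβm hsI hs, mul_one]
  rfl

/-- A character of level `m = 2n + d - 1` is non-trivial on `1 + 𝔭_F^(m/2)`. -/
lemma exists_char_ne_one [CharP F 2] (D : WildQuadraticData F E d) {n m : ℕ}
    (hm : m + 1 = 2 * n + d) (hn : 1 ≤ n) {K : Type*} [Field K] {θ : Eˣ →* Kˣ}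
    (hθ : charLevel θ = m) :
    (∀ t : Eˣ, (t : E) - 1 ∈ pPow E (m + 1) → θ t = 1) ∧
      ∃ (y : F) (t : Eˣ), algebraMap F E y ∈ pPow E m ∧ (t : E) = 1 + algebraMap F E y ∧
        θ t ≠ 1 := by
  have hd := D.d_pos
  have htriv : ∀ t : Eˣ, (t : E) - 1 ∈ pPow E (m + 1) → θ t = 1 := by
    have hne : {k : ℕ | ∀ t : Eˣ, (t : E) - 1 ∈ pPow E ((k : ℤ) + 1) → θ t = 1}.Nonempty := by
      -- Were the set empty, its `sInf` would be the default value 0, whereas `m ≥ 2`.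
      by_contra h
      rw [Set.not_nonempty_iff_eq_empty] at h
      rw [charLevel, h, Nat.sInf_empty] at hθ
      omega
    have := Nat.sInf_mem hne
    rw [show sInf _ = m from hθ] at this
    exact this
  refine ⟨htriv, ?_⟩
  have hnot : m - 1 ∉ {k : ℕ | ∀ t : Eˣ, (t : E) - 1 ∈ pPow E ((k : ℤ) + 1) → θ t = 1} := by
    refine Nat.notMem_of_lt_sInf ?_
    rw [show sInf _ = m from hθ]
    omega
  simp only [Set.mem_ofPred_eq, not_forall] at hnot
  obtain ⟨t, ht, hne⟩ := hnot
  obtain ⟨y, z, hyz⟩ := D.exists_coords ((t : E) - 1)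
  rw [show ((m - 1 : ℕ) : ℤ) + 1 = m by omega, hyz] at ht
  obtain ⟨hy, hz⟩ := D.coords_mem ht
  -- Since `d` is odd, `m` is even, while `zπ` has odd valuation if `z ≠ 0`; lying in `𝔭^m`, it lies
  -- in `𝔭^(m+1)`.
  have hz' : algebraMap F E z * D.π ∈ pPow E (m + 1) := by
    obtain ⟨e, he⟩ := D.d_odd
    have := D.mem_pPow_of_algebraMap_mul_π hz (i := n + e) (by omega)
    exact mul_mem_pPow (D.algebraMap_mem_pPow this le_rfl) (mem_pPow_of_ord D.ord_π') (by omega)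
  have hs0 : ord E (1 + algebraMap F E y) = (0 : ℤ) :=
    ord_add_of ord_one (pPow_mono (by omega) hy)
  refine ⟨y, Units.mk0 _ (ne_zero_of_ord hs0), hy, rfl, fun hs => hne ?_⟩
  set s : Eˣ := Units.mk0 _ (ne_zero_of_ord hs0) with hsdef
  -- Thus `t` and `1 + y`, with `y ∈ F`, differ by a factor in `1 + 𝔭^(m+1)`, which θ does not see.
  have hts : θ (s⁻¹ * t) = 1 := by
    refine htriv _ ?_
    have e : ((s⁻¹ * t : Eˣ) : E) - 1 = (1 + algebraMap F E y)⁻¹ * (algebraMap F E z * D.π) := by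
      have : (t : E) = 1 + algebraMap F E y + algebraMap F E z * D.π := by
        linear_combination hyz
      rw [Units.val_mul, Units.val_inv_eq_inv_val, hsdef, Units.val_mk0, this, mul_add,
        inv_mul_cancel₀ (ne_zero_of_ord hs0)]
      ring
    rw [e]
    exact mul_mem_pPow (mem_pPow_of_ord (ord_inv_of hs0 rfl)) hz' (by omega)
  rwa [map_mul, map_inv, hs, inv_one, one_mul] at hts

end WildQuadraticData

end Characters

/-! ### The Γ̃-orbits and their translation by `e_-(u)`. -/

section Orbits

variable {F E : Type*} [Field F] [ValuativeRel F] [TopologicalSpace F]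
  [IsNonarchimedeanLocalField F] [Field E] [ValuativeRel E] [TopologicalSpace E]
  [IsNonarchimedeanLocalField E] [Algebra F E] {d : ℕ}

lemma eMinus_add {R : Type*} [CommRing R] (a b : R) : eMinus (a + b) = eMinus a * eMinus b := by
  ext i j
  fin_cases i <;> fin_cases j <;> simp [eMinus]

variable (F) in
/-- The index set of the `Γ̃`-orbits: pairs of a class in `𝔭_F / 𝔭_F^c` and a unit class in
`O_F / 𝔭_F^c'`. -/
abbrev OrbitIndex (n d : ℕ) : Type _ :=
  PQuot F 1 ((n + d + 2) / 2 : ℕ) ×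
    {h : PQuot F 0 ((n + d + 1) / 2 : ℕ) // h ∉ pQuotOne F ((n + d + 1) / 2 : ℕ)}

/-- The trace part of the chosen representative. -/
noncomputable def OrbitIndex.base {n d : ℕ} (p : OrbitIndex F n d) : F :=
  (Quotient.out p.1 : pPow F 1).1

/-- The unit part of the chosen representative. -/
noncomputable def OrbitIndex.unit {n d : ℕ} (p : OrbitIndex F n d) : F :=
  (Quotient.out p.2.1 : pPow F 0).1

lemma OrbitIndex.ord_unit {n d : ℕ} (hn : 1 ≤ n) (p : OrbitIndex F n d) (hd : 0 < d) :
    ord F p.unit = (0 : ℤ) :=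
  ord_out (by omega) p.2

namespace WildQuadraticData

/-- The element `a₀ + π / b` of valuation one attached to an index. -/
noncomputable def indexPoint (D : WildQuadraticData F E d) {n : ℕ} (p : OrbitIndex F n d) : E :=
  algebraMap F E p.base + algebraMap F E p.unit⁻¹ * D.π

lemma ord_indexPoint (D : WildQuadraticData F E d) {n : ℕ} (hn : 1 ≤ n) (p : OrbitIndex F n d) :
    ord E (D.indexPoint p) = (1 : ℤ) := by
  rw [indexPoint, add_comm]
  refine ord_add_of ?_ (D.algebraMap_mem_pPow (Quotient.out p.1 : pPow F 1).2 (by omega))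
  exact ord_mul_of (D.ord_algebraMap_of (ord_inv_of (p.ord_unit hn D.d_pos) rfl) rfl) D.ord_π'
    (by omega)

/-- Indexing by the inverse `b` of the coordinate along `π` makes `1 / (a + τ(a)) = b/Δ` linear in
`b`; this is what turns the trace into a sum of an additive character. -/
lemma indexPoint_add_τ [CharP F 2] (D : WildQuadraticData F E d) {n : ℕ} (p : OrbitIndex F n d) :
    D.indexPoint p + D.τ (D.indexPoint p) = algebraMap F E (D.Δ * p.unit⁻¹) := by
  have : CharP E 2 := charP_of_injective_algebraMap (algebraMap F E).injective 2
  rw [indexPoint, map_add, map_mul, AlgEquiv.commutes, AlgEquiv.commutes, map_mul, D.π_trace]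
  linear_combination CharTwo.add_self_eq_zero (algebraMap F E p.base)

/-- Every element of valuation one is congruent to one of the representatives. -/
lemma exists_indexPoint (D : WildQuadraticData F E d) {n : ℕ} (hn : 1 ≤ n) {a : E}
    (ha : ord E a = (1 : ℤ)) :
    ∃ p : OrbitIndex F n d, D.indexPoint p - a ∈ pPow E (n + d + 1) := by
  have hd := D.d_pos
  obtain ⟨x, y, rfl⟩ := D.exists_coords a
  obtain ⟨hx, hy⟩ := D.coords_mem (mem_pPow_of_ord ha)
  have hx' := D.mem_pPow_of_algebraMap hx (i := 1) (by omega)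
  have hy' := D.mem_pPow_of_algebraMap_mul_π hy (i := 0) (by omega)
  have hy0 : ord F y = (0 : ℤ) := by
    refine ord_eq_iff.2 ⟨hy', fun h => ?_⟩
    refine (ord_eq_iff.1 ha).2 (add_mem (D.algebraMap_mem_pPow hx' (by omega)) ?_)
    exact mul_mem_pPow (D.algebraMap_mem_pPow h le_rfl) (mem_pPow_of_ord D.ord_π') (by omega)
  have hyi := ord_inv_of hy0 (k := 0) (by omega)
  have hb : (QuotientAddGroup.mk ⟨y⁻¹, mem_pPow_of_ord hyi⟩ : PQuot F 0 ((n + d + 1) / 2 : ℕ)) ∉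
      pQuotOne F ((n + d + 1) / 2 : ℕ) := by
    rw [mk_mem_pQuotOne (by omega)]
    exact (ord_eq_iff.1 hyi).2
  set p : OrbitIndex F n d := (QuotientAddGroup.mk ⟨x, hx'⟩, ⟨_, hb⟩) with hp
  refine ⟨p, ?_⟩
  -- The exponents in `OrbitIndex` are `⌈(n+d+1)/2⌉` and `⌈(n+d)/2⌉`: these are the conditions on
  -- `x` and `y` for `x + yπ` to lie in `𝔭_E^(n+d+1)`.
  have e1 : -p.base + x ∈ pPow F ((n + d + 2) / 2 : ℕ) :=
    AddSubgroup.mem_addSubgroupOf.1 (QuotientAddGroup.eq.1 (QuotientAddGroup.out_eq' p.1))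
  have e2 : -p.unit + y⁻¹ ∈ pPow F ((n + d + 1) / 2 : ℕ) :=
    AddSubgroup.mem_addSubgroupOf.1 (QuotientAddGroup.eq.1 (QuotientAddGroup.out_eq' p.2.1))
  have hu := p.ord_unit hn D.d_pos
  have hu0 := ne_zero_of_ord hu
  have hy00 := ne_zero_of_ord hy0
  have e3 : p.unit⁻¹ - y ∈ pPow F ((n + d + 1) / 2 : ℕ) := by
    rw [show p.unit⁻¹ - y = (-p.unit + y⁻¹) * (p.unit⁻¹ * y) by field_simp; ring]
    exact mul_mem_pPow e2 (mem_pPow_of_ord (ord_mul_of (ord_inv_of hu rfl) hy0 rfl)) (by omega)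
  rw [indexPoint, show algebraMap F E p.base + algebraMap F E p.unit⁻¹ * D.π -
    (algebraMap F E x + algebraMap F E y * D.π) = -algebraMap F E (-p.base + x) +
      algebraMap F E (p.unit⁻¹ - y) * D.π by simp only [map_add, map_neg, map_sub]; ring]
  exact add_mem (neg_mem (D.algebraMap_mem_pPow e1 (by omega)))
    (mul_mem_pPow (D.algebraMap_mem_pPow e3 le_rfl) (mem_pPow_of_ord D.ord_π') (by omega))

/-- Units are congruent modulo a power of `𝔭_F` exactly when their inverses are, so indexing by the
inverse of the coordinate keeps the classes apart. -/
lemma indexPoint_inj (D : WildQuadraticData F E d) {n : ℕ} (hn : 1 ≤ n) {p p' : OrbitIndex F n d}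
    (h : D.indexPoint p' - D.indexPoint p ∈ pPow E (n + d + 1)) : p = p' := by
  have hd := D.d_pos
  rw [indexPoint, indexPoint, show algebraMap F E p'.base + algebraMap F E p'.unit⁻¹ * D.π -
    (algebraMap F E p.base + algebraMap F E p.unit⁻¹ * D.π) = algebraMap F E (-p.base + p'.base) +
      algebraMap F E (p'.unit⁻¹ - p.unit⁻¹) * D.π by
        simp only [map_add, map_neg, map_sub]; ring] at h
  obtain ⟨h1, h2⟩ := D.coords_mem h
  have e1 := D.mem_pPow_of_algebraMap h1 (i := ((n + d + 2) / 2 : ℕ)) (by omega)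
  have e2 := D.mem_pPow_of_algebraMap_mul_π h2 (i := ((n + d + 1) / 2 : ℕ)) (by omega)
  have hu := p.ord_unit hn D.d_pos
  have hu' := p'.ord_unit hn D.d_pos
  have hu0 := ne_zero_of_ord hu
  have hu0' := ne_zero_of_ord hu'
  have e3 : -p.unit + p'.unit ∈ pPow F ((n + d + 1) / 2 : ℕ) := by
    rw [show -p.unit + p'.unit = (p'.unit⁻¹ - p.unit⁻¹) * (-(p.unit * p'.unit)) by
      field_simp; ring]
    exact mul_mem_pPow e2 (neg_mem (mem_pPow_of_ord (ord_mul_of hu hu' rfl))) (by omega)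
  refine Prod.ext ?_ (Subtype.ext ?_)
  · rw [← QuotientAddGroup.out_eq' p.1, ← QuotientAddGroup.out_eq' p'.1]
    exact QuotientAddGroup.eq.2 (AddSubgroup.mem_addSubgroupOf.2 e1)
  · rw [← QuotientAddGroup.out_eq' p.2.1, ← QuotientAddGroup.out_eq' p'.2.1]
    exact QuotientAddGroup.eq.2 (AddSubgroup.mem_addSubgroupOf.2 e3)

lemma rep_cond [CharP F 2] (D : WildQuadraticData F E d) (n m : ℕ) {a : E}
    (ha : ord E a = (1 : ℤ)) : (D.rep n ha)⁻¹ * D.τG (D.rep n ha) ∈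
      DoubleCoset.doubleCoset (D.wDot n) (levelSubgroup E (2 * m + 1) : Set (GL (Fin 2) E))
        (levelSubgroup E (2 * m + 1)) := by
  rw [τG_rep, inv_mul_cancel_left]
  exact DoubleCoset.mem_doubleCoset_self _ _ _

lemma mk_rep_mem [CharP F 2] (D : WildQuadraticData F E d) {n : ℕ} (m : ℕ) (hn : 1 ≤ n) {a : E}
    (ha : ord E a = (1 : ℤ)) :
    (QuotientGroup.mk (D.rep n ha) : GL (Fin 2) E ⧸ levelSubgroup E (2 * m + 1)) ∈
      XTilde D n m := by
  obtain ⟨i, hi, h⟩ := D.rep_mem_cell hn ha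
  exact subset_XTilde D (mk_mem_xHalf D ⟨a, ha, i, hi, h⟩ (D.rep_cond n m ha))

/-- Representatives of the `Γ̃`-orbits. -/
noncomputable def orbitRep [CharP F 2] (D : WildQuadraticData F E d) {n : ℕ} (m : ℕ) (hn : 1 ≤ n)
    (p : OrbitIndex F n d) : XTilde D n m :=
  ⟨QuotientGroup.mk (D.rep n (D.ord_indexPoint hn p)), D.mk_rep_mem m hn _⟩

/-- Both `γ` and J lie in `E^× I_E`, and modulo that group only the parameter modulo `𝔭_E^(n+d+1)`
is visible. The parameter of `e_-(u) · rep` is `u + a`. -/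
lemma rep_eq_of_mk_eq [CharP F 2] (D : WildQuadraticData F E d) {n m : ℕ} (hn : 1 ≤ n) {u a b : E}
    (ha : ord E a = (1 : ℤ)) (hb : ord E b = (1 : ℤ)) (γ : rawGamma D n m)
    (h : (QuotientGroup.mk (eMinus u * D.rep n ha) : GL (Fin 2) E ⧸ levelSubgroup E (2 * m + 1)) =
      QuotientGroup.mk (D.rep n hb * γ.1⁻¹)) : u + a - b ∈ pPow E (n + d + 1) := by
  obtain ⟨i, hi, hi'⟩ := D.rep_mem_cell hn ha
  obtain ⟨j, hj, hj'⟩ := D.rep_mem_cell hn hb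
  rw [← D.cell_inv_mul_mem_iff hj hi, eMinus_add, mul_assoc (eMinus u), mul_assoc (eMinus u),
    ← hi', ← hj']
  have h' := iwahori_le_centerIwahori (levelSubgroup_le _ (QuotientGroup.eq.1 h.symm))
  have := mul_mem (inv_mem γ.2.1) h'
  rw [mul_inv_rev, inv_inv] at this
  simpa [mul_assoc] using this

/-- Injectivity: the orbit determines the parameter, and `xγ⁻¹J = xJ` puts `γ` in J. Surjectivity: a
point of X over the cell and the representative with congruent parameter differ by an element of
`E^× I_E`, which belongs to Γ̃ because both points satisfy the defining condition of X. -/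
lemma orbitRep_bijective [CharP F 2] (D : WildQuadraticData F E d) {n : ℕ} (m : ℕ) (hn : 1 ≤ n) :
    Function.Bijective fun p : GammaTilde D n m × OrbitIndex F n d =>
      rightAction D n m p.1 (D.orbitRep m hn p.2) := by
  constructor
  · rintro ⟨γ, p⟩ ⟨γ', p'⟩ h
    obtain ⟨δ, hδ⟩ := toGammaTilde_surjective D n m (γ⁻¹ * γ')
    have h1 : D.orbitRep m hn p = rightAction D n m (toGammaTilde D n m δ) (D.orbitRep m hn p') := by
      have : rightAction D n m γ (D.orbitRep m hn p) =
        rightAction D n m γ' (D.orbitRep m hn p') := h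
      rw [hδ, map_mul, Equiv.Perm.mul_apply, ← this, ← Equiv.Perm.mul_apply, ← map_mul,
        inv_mul_cancel, map_one, Equiv.Perm.one_apply]
    have h2 : (QuotientGroup.mk (D.rep n (D.ord_indexPoint hn p)) :
        GL (Fin 2) E ⧸ levelSubgroup E (2 * m + 1)) =
        QuotientGroup.mk (D.rep n (D.ord_indexPoint hn p') * δ.1⁻¹) := congrArg Subtype.val h1
    have he : eMinus (0 : E) = 1 := by
      ext i j
      fin_cases i <;> fin_cases j <;> simp [eMinus]
    have h3 := D.rep_eq_of_mk_eq hn (u := 0) _ _ δ (by rw [he, one_mul]; exact h2)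
    rw [zero_add] at h3
    obtain rfl := D.indexPoint_inj hn h3
    rw [QuotientGroup.eq, inv_mul_cancel_left] at h2
    have h4 : toGammaTilde D n m δ = 1 :=
      (QuotientGroup.eq_one_iff _).2 (Subgroup.mem_subgroupOf.2 (by simpa using h2))
    rw [h4, eq_comm, inv_mul_eq_one] at hδ
    rw [hδ]
  · rintro ⟨_, γ, c, hc, rfl⟩
    obtain ⟨x, ⟨a, ha, i, hi, rfl⟩, rfl, hx⟩ := exists_rep D hc
    have ha' : ord E a = (1 : ℤ) := ha
    obtain ⟨p, hp⟩ := D.exists_indexPoint hn ha'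
    obtain ⟨j, hj, hrep⟩ := D.rep_mem_cell hn (D.ord_indexPoint hn p)
    have hmem := (D.cell_inv_mul_mem_iff hi hj).2 hp
    rw [← hrep] at hmem
    have hmem' := D.mem_rawGamma_of_mem hmem hx
      (by rw [mul_inv_cancel_left]; exact D.rep_cond n m _)
    refine ⟨(γ * toGammaTilde D n m ⟨_, hmem'⟩, p), ?_⟩
    apply Subtype.ext
    change gammaAction D n m (γ * toGammaTilde D n m ⟨_, hmem'⟩)
      (QuotientGroup.mk (D.rep n (D.ord_indexPoint hn p))) = _
    rw [map_mul, Equiv.Perm.mul_apply, gammaAction_mk]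
    congr 2
    group

lemma leftAction_orbitRep [CharP F 2] (D : WildQuadraticData F E d) {n : ℕ} (m : ℕ) (hn : 1 ≤ n)
    {u : F} (hu : 1 ≤ ord F u) (p : OrbitIndex F n d) :
    (leftAction D n m (unipotent D u hu) (D.orbitRep m hn p)).1 =
      QuotientGroup.mk (eMinus (algebraMap F E u) * D.rep n (D.ord_indexPoint hn p)) := by
  change QuotientGroup.mk (D.incl (eMinus u) * D.rep n (D.ord_indexPoint hn p)) = _
  congr 2
  ext i j
  fin_cases i <;> fin_cases j <;> simp [eMinus, incl]

lemma Xi_mk [CharP F 2] (D : WildQuadraticData F E d) (n m : ℕ) {K : Type*} [Field K]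
    (χ : GammaTilde D n m →* Kˣ) (g : D.torusIwahori) (s : XTilde D n m) :
    Xi D n m χ g ((isotypicKernel (cohomologyRep K (rightAction D n m)) χ).mkQ
      (Finsupp.single s 1)) = (isotypicKernel (cohomologyRep K (rightAction D n m)) χ).mkQ
        (Finsupp.single (leftAction D n m g s) 1) := by
  change (isotypicKernel (cohomologyRep K (rightAction D n m)) χ).mkQ
    (cohomologyRep K (leftAction D n m) g (Finsupp.single s 1)) = _
  rw [cohomologyRep_single]

/-- The parameter moves from `a` to `a + u`, which is a different class modulo `𝔭_E^(n+d+1)`. -/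
lemma not_fixed [CharP F 2] (D : WildQuadraticData F E d) {n : ℕ} (m : ℕ) (hn : 1 ≤ n)
    {u : F} (hu : 1 ≤ ord F u) (hu' : algebraMap F E u ∉ pPow E (n + d + 1))
    (p : OrbitIndex F n d) (γ : GammaTilde D n m) :
    leftAction D n m (unipotent D u hu) (D.orbitRep m hn p) ≠
      rightAction D n m γ (D.orbitRep m hn p) := by
  intro h
  obtain ⟨δ, rfl⟩ := toGammaTilde_surjective D n m γ
  have h' := congrArg Subtype.val h
  rw [leftAction_orbitRep] at h'
  have := D.rep_eq_of_mk_eq hn _ _ δ h'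
  rw [add_sub_cancel_right] at this
  exact hu' this

/-- Γ̃ acts by inverses on the right, but `unip` is an involution, so no inverse survives; its
parameter is `u / (a + τ(a)) = (u/Δ) · b`. -/
lemma fixed [CharP F 2] (D : WildQuadraticData F E d) {n : ℕ} (m : ℕ) (hn : 1 ≤ n)
    {u : F} (hu : 1 ≤ ord F u) (p : OrbitIndex F n d)
    (hw : u / D.Δ * p.unit ∈ pPow F ((n + 1) / 2 : ℕ)) :
    leftAction D n m (unipotent D u hu) (D.orbitRep m hn p) =
      rightAction D n m (D.unipHom m hn (Multiplicative.ofAdd ⟨_, hw⟩)) (D.orbitRep m hn p) := by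
  apply Subtype.ext
  rw [leftAction_orbitRep, eMinus_mul_rep, unipHom_apply]
  change _ = QuotientGroup.mk (D.rep n (D.ord_indexPoint hn p) * (D.unip n _)⁻¹)
  rw [unip_inv, indexPoint_add_τ, ← map_div₀]
  congr 4
  rw [← div_div, div_inv_eq_mul]

lemma char_unip_eq_one [CharP F 2] (D : WildQuadraticData F E d) {n m : ℕ}
    (hm : m + 1 = 2 * n + d) (hn : 1 ≤ n) {K : Type*} [Field K] {χ : GammaTilde D n m →* Kˣ}
    {θ : Eˣ →* Kˣ} (hθ : charLevel θ = m) (hχ : ∀ t, χ (torusHom D n m t) = θ t)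
    (w : pPow F ((n + 1) / 2 : ℕ)) (hw : algebraMap F E (w : F) ∈ pPow E (m + 1)) :
    χ (D.unipHom m hn (Multiplicative.ofAdd w)) = 1 := by
  have h0 : ord E (1 + algebraMap F E (w : F)) = (0 : ℤ) :=
    ord_add_of ord_one (pPow_mono (by omega) hw)
  rw [D.char_unip hm hn χ w (pPow_mono (by omega) hw) (t := Units.mk0 _ (ne_zero_of_ord h0)) rfl,
    hχ]
  refine (D.exists_char_ne_one hm hn hθ).1 _ ?_
  rwa [Units.val_mk0, add_sub_cancel_left]

/-- The additive character of `O_F / 𝔭_F^c` obtained from the restriction of a character of `Γ̃`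
to unipotent matrices. -/
lemma exists_addChar [CharP F 2] (D : WildQuadraticData F E d) {n m : ℕ}
    (hm : m + 1 = 2 * n + d) (hn : 1 ≤ n) {K : Type*} [Field K] {χ : GammaTilde D n m →* Kˣ}
    {θ : Eˣ →* Kˣ} (hθ : charLevel θ = m) (hχ : ∀ t, χ (torusHom D n m t) = θ t)
    {w : F} (hw : w ∈ pPow F ((n + 1) / 2 : ℕ)) :
    ∃ ψ : AddChar (PQuot F 0 ((n + d + 1) / 2 : ℕ)) K,
      ∀ (b : pPow F 0) (hb : w * b ∈ pPow F ((n + 1) / 2 : ℕ)),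
        ψ (QuotientAddGroup.mk b) = χ (D.unipHom m hn (Multiplicative.ofAdd ⟨w * b, hb⟩)) := by
  obtain ⟨e, he⟩ := D.d_odd
  have hmem : ∀ b : pPow F 0, w * b ∈ pPow F ((n + 1) / 2 : ℕ) := fun b =>
    mul_mem_pPow hw b.2 (by omega)
  let f : pPow F 0 →+ Additive Kˣ :=
    { toFun := fun b => Additive.ofMul
        (χ (D.unipHom m hn (Multiplicative.ofAdd ⟨w * b, hmem b⟩)))
      map_zero' := by
        have : (⟨w * (0 : pPow F 0), hmem 0⟩ : pPow F ((n + 1) / 2 : ℕ)) = 0 :=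
          Subtype.ext (mul_zero w)
        rw [this]
        simp
      map_add' := fun b b' => by
        have : (⟨w * (b + b' : pPow F 0), hmem _⟩ : pPow F ((n + 1) / 2 : ℕ)) =
          ⟨w * b, hmem b⟩ + ⟨w * b', hmem b'⟩ := Subtype.ext (mul_add w _ _)
        rw [this, ofAdd_add, map_mul, map_mul, ofMul_mul] }
  -- For `d` odd, `2⌊(n+1)/2⌋ + 2⌊(n+d+1)/2⌋ = 2n + d + 1 > m`, so `wb` falls in `𝔭_E^(m+1)`, where
  -- the character is trivial.
  have hf : (pPow F ((n + d + 1) / 2 : ℕ)).addSubgroupOf (pPow F 0) ≤ f.ker := by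
    intro b hb
    have hb' : (b : F) ∈ pPow F ((n + d + 1) / 2 : ℕ) := AddSubgroup.mem_addSubgroupOf.1 hb
    refine congrArg Additive.ofMul (D.char_unip_eq_one hm hn hθ hχ ⟨w * b, hmem b⟩ ?_)
    exact D.algebraMap_mem_pPow (mul_mem_pPow hw hb' le_rfl) (by omega)
  refine ⟨⟨fun h => ((QuotientAddGroup.lift _ f hf h).toMul : Kˣ), by simp, fun a b => by simp⟩,
    fun b hb => rfl⟩

end WildQuadraticData

end Orbits

/-! ### The trace as an exponential sum, and the conductor of its character. -/

section Trace

variable {F E : Type*} [Field F] [ValuativeRel F] [TopologicalSpace F]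
  [IsNonarchimedeanLocalField F] [Field E] [ValuativeRel E] [TopologicalSpace E]
  [IsNonarchimedeanLocalField E] [Algebra F E] {d : ℕ}

lemma finite_orbitIndex {p : F} (hp : ord F p = (1 : ℤ)) (n d : ℕ) :
    Finite (OrbitIndex F n d) := by
  have := finite_pQuot hp (i := 1) (j := ((n + d + 2) / 2 : ℕ)) (k := (n + d) / 2) (by omega)
  have := finite_pQuot hp (i := 0) (j := ((n + d + 1) / 2 : ℕ)) (k := (n + d + 1) / 2) (by omega)
  infer_instance

namespace WildQuadraticData

lemma finiteDimensional_isotypicPart [CharP F 2] (D : WildQuadraticData F E d) {n : ℕ} (m : ℕ)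
    (hn : 1 ≤ n) {K : Type*} [Field K] (χ : GammaTilde D n m →* Kˣ) :
    FiniteDimensional K (IsotypicPart (cohomologyRep K (rightAction D n m)) χ) :=
  have := finite_orbitIndex (F := F) (p := D.ϖ) D.ord_ϖ n d
  Module.Finite.of_basis (isotypicBasis _ χ (D.orbitRep m hn) (D.orbitRep_bijective m hn))

/-- If `e_-(u)` does not fix any orbit, its trace vanishes. -/
lemma trace_eq_zero_of_notMem [CharP F 2] (D : WildQuadraticData F E d) {n : ℕ} (m : ℕ)
    (hn : 1 ≤ n) {K : Type*} [Field K] (χ : GammaTilde D n m →* Kˣ) {u : F} (hu : 1 ≤ ord F u)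
    (hu' : algebraMap F E u ∉ pPow E (n + d + 1)) :
    LinearMap.trace _ _ (Xi D n m χ (unipotent D u hu)) = 0 := by
  have := finite_orbitIndex (F := F) (p := D.ϖ) D.ord_ϖ n d
  have := Fintype.ofFinite (OrbitIndex F n d)
  rw [trace_isotypic _ χ (D.orbitRep m hn) (D.orbitRep_bijective m hn) _
    (leftAction D n m (unipotent D u hu)) (Xi_mk D n m χ _) (fun _ => 0) (fun _ _ => rfl)
    fun p γ h => absurd h (D.not_fixed m hn hu hu' p γ)]
  simp

lemma mem_pPow_div_Δ (D : WildQuadraticData F E d) {u : F} {k : ℤ} (hu : u ∈ pPow F k) :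
    u / D.Δ ∈ pPow F (k - ((d + 1) / 2 : ℕ)) := by
  rw [div_eq_mul_inv]
  exact mul_mem_pPow hu (mem_pPow_of_ord (ord_inv_of D.ord_Δ rfl)) (by omega)

open Classical in
/-- If `e_-(u)` fixes all orbits, its trace is an exponential sum over unit classes. -/
lemma trace_eq_of_mem [CharP F 2] (D : WildQuadraticData F E d) {n m : ℕ}
    (hn : 1 ≤ n) {K : Type*} [Field K] {χ : GammaTilde D n m →* Kˣ} {u : F} (hu : 1 ≤ ord F u)
    (hw : u / D.Δ ∈ pPow F ((n + 1) / 2 : ℕ))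
    (ψ : AddChar (PQuot F 0 ((n + d + 1) / 2 : ℕ)) K)
    (hψ : ∀ (b : pPow F 0) (hb : u / D.Δ * b ∈ pPow F ((n + 1) / 2 : ℕ)),
      ψ (QuotientAddGroup.mk b) = χ (D.unipHom m hn (Multiplicative.ofAdd ⟨u / D.Δ * b, hb⟩))) :
    LinearMap.trace _ _ (Xi D n m χ (unipotent D u hu)) = (residueCard F : K) ^ ((n + d) / 2) *
      ((if ∀ h, ψ h = 1 then (residueCard F : K) ^ ((n + d + 1) / 2) else 0) -
        if ∀ h ∈ pQuotOne F ((n + d + 1) / 2 : ℕ), ψ h = 1 then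
          (residueCard F : K) ^ ((n + d + 1) / 2 - 1) else 0) := by
  have hp : ord F D.ϖ = (1 : ℤ) := D.ord_ϖ
  have := finite_orbitIndex hp n d
  have := finite_pQuot hp (i := 1) (j := ((n + d + 2) / 2 : ℕ)) (k := (n + d) / 2) (by omega)
  have := finite_pQuot hp (i := 0) (j := ((n + d + 1) / 2 : ℕ)) (k := (n + d + 1) / 2) (by omega)
  have := Fintype.ofFinite (PQuot F 1 ((n + d + 2) / 2 : ℕ))
  have := Fintype.ofFinite (PQuot F 0 ((n + d + 1) / 2 : ℕ))
  have hfix : ∀ p : OrbitIndex F n d, u / D.Δ * p.unit ∈ pPow F ((n + 1) / 2 : ℕ) := fun p =>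
    mul_mem_pPow hw (Quotient.out p.2.1 : pPow F 0).2 (by omega)
  rw [trace_isotypic _ χ (D.orbitRep m hn) (D.orbitRep_bijective m hn) _
    (leftAction D n m (unipotent D u hu)) (Xi_mk D n m χ _) (fun p => ψ p.2.1)
    (fun p h => absurd (D.fixed m hn hu p (hfix p)) (h _)) ?_]
  -- The summand ignores the class in `𝔭_F / 𝔭_F^⌊(n+d+2)/2⌋`, which only contributes the factor
  -- `q^⌊(n+d)/2⌋`.
  · rw [Fintype.sum_prod_type]
    simp only
    rw [Finset.sum_const, sum_addChar_compl, Finset.card_univ,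
      ← Nat.card_eq_fintype_card, card_pQuot hp (k := (n + d) / 2) (by omega),
      card_pQuot hp (k := (n + d + 1) / 2) (by omega), card_pQuotOne hp (by omega)]
    simp [nsmul_eq_mul]
  · intro p γ h
    -- By freeness, the unipotent element is the only `γ` moving the representative as `e_-(u)`
    -- does.
    have h' := (D.fixed m hn hu p (hfix p)).symm.trans h
    have := (D.orbitRep_bijective m hn).1 (a₁ := (_, p)) (a₂ := (γ, p)) h'
    have hγ : D.unipHom m hn (Multiplicative.ofAdd ⟨_, hfix p⟩) = γ := (Prod.ext_iff.1 this).1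
    rw [← hγ]
    exact (congrArg ψ (QuotientAddGroup.out_eq' p.2.1).symm).trans (hψ _ (hfix p))

/-- The additive character attached to `u` is trivial on `𝔭_F^i` if `ord u ≥ n + d + 1 - i`. -/
lemma addChar_eq_one [CharP F 2] (D : WildQuadraticData F E d) {n m : ℕ}
    (hm : m + 1 = 2 * n + d) (hn : 1 ≤ n) {K : Type*} [Field K] {χ : GammaTilde D n m →* Kˣ}
    {θ : Eˣ →* Kˣ} (hθ : charLevel θ = m) (hχ : ∀ t, χ (torusHom D n m t) = θ t) {w : F}
    (hw : w ∈ pPow F ((n + 1) / 2 : ℕ))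
    {ψ : AddChar (PQuot F 0 ((n + d + 1) / 2 : ℕ)) K}
    (hψ : ∀ (b : pPow F 0) (hb : w * b ∈ pPow F ((n + 1) / 2 : ℕ)),
      ψ (QuotientAddGroup.mk b) = χ (D.unipHom m hn (Multiplicative.ofAdd ⟨w * b, hb⟩)))
    {i : ℤ} (hi : w ∈ pPow F (n + ((d + 1) / 2 : ℕ) - i)) (b : pPow F 0)
    (hb : (b : F) ∈ pPow F i) : ψ (QuotientAddGroup.mk b) = 1 := by
  have hd := D.two_half
  -- Here `wb` has valuation at least `n + (d+1)/2` in `F`, hence at least `2n + d + 1 > m` in `E`.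
  rw [hψ b (mul_mem_pPow hw b.2 (by omega)), Units.val_eq_one]
  exact D.char_unip_eq_one hm hn hθ hχ _
    (D.algebraMap_mem_pPow (mul_mem_pPow hi hb le_rfl) (by omega))

/-- The additive character attached to `u` is non-trivial on `𝔭_F^i` if `ord u = n + d - i`. -/
lemma addChar_ne_one [CharP F 2] (D : WildQuadraticData F E d) {n m : ℕ}
    (hm : m + 1 = 2 * n + d) (hn : 1 ≤ n) {K : Type*} [Field K] {χ : GammaTilde D n m →* Kˣ}
    {θ : Eˣ →* Kˣ} (hθ : charLevel θ = m) (hχ : ∀ t, χ (torusHom D n m t) = θ t) {u : F}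
    {ψ : AddChar (PQuot F 0 ((n + d + 1) / 2 : ℕ)) K}
    (hψ : ∀ (b : pPow F 0) (hb : u / D.Δ * b ∈ pPow F ((n + 1) / 2 : ℕ)),
      ψ (QuotientAddGroup.mk b) = χ (D.unipHom m hn (Multiplicative.ofAdd ⟨u / D.Δ * b, hb⟩)))
    {i : ℤ} (hi : 0 ≤ i) (hu : ord F u = ((n + d - i : ℤ) : WithTop ℤ)) :
    ∃ b : pPow F 0, (b : F) ∈ pPow F i ∧ ψ (QuotientAddGroup.mk b) ≠ 1 := by
  have hd := D.two_half
  have hd0 := D.d_pos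
  obtain ⟨y, t, hy, ht, hne⟩ := (D.exists_char_ne_one hm hn hθ).2
  have hw := ord_mul_of hu (ord_inv_of D.ord_Δ rfl) rfl
  rw [← div_eq_mul_inv] at hw
  -- The witness is the `b` with `(u/Δ) b = y`, where `θ(1 + y) ≠ 1`. Since `ord y ≥ m/2 = n +
  -- (d+1)/2 - 1` and `ord(u/Δ) = n + d - i - (d+1)/2`, it satisfies `ord b ≥ i`.
  have hyF := D.mem_pPow_of_algebraMap hy (i := n + ((d + 1) / 2 : ℕ) - 1) (by omega)
  have hb : y * (u / D.Δ)⁻¹ ∈ pPow F i :=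
    mul_mem_pPow hyF (mem_pPow_of_ord (ord_inv_of hw rfl)) (by omega)
  have e : u / D.Δ * (y * (u / D.Δ)⁻¹) = y := by
    rw [mul_left_comm, mul_inv_cancel₀ (ne_zero_of_ord hw), mul_one]
  have hy' : algebraMap F E (u / D.Δ * (y * (u / D.Δ)⁻¹)) ∈ pPow E m := by rwa [e]
  have ht' : (t : E) = 1 + algebraMap F E (u / D.Δ * (y * (u / D.Δ)⁻¹)) := by rwa [e]
  refine ⟨⟨_, pPow_mono hi hb⟩, hb, ?_⟩
  rw [hψ _ (by rw [e]; exact pPow_mono (by omega) hyF), Ne, Units.val_eq_one,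
    D.char_unip hm hn χ _ hy' ht', hχ]
  exact hne

end WildQuadraticData

end Trace
end WildGL2

/-! ### The three cases of the trace formula. -/

theorem mainTheorem9
    {F E : Type*} [Field F] [ValuativeRel F] [TopologicalSpace F] [IsNonarchimedeanLocalField F]
    [CharP F 2] [Field E] [ValuativeRel E] [TopologicalSpace E] [IsNonarchimedeanLocalField E]
    [Algebra F E] {d : ℕ} (D : WildGL2.WildQuadraticData F E d)
    (ℓ : ℕ) [Fact ℓ.Prime] (n m : ℕ) (hm : m + 1 = 2 * n + d) (hn : d < 2 * n)
    (θ : Eˣ →* (AlgebraicClosure ℚ_[ℓ])ˣ) (hθ : WildGL2.charLevel θ = m)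
    (θt : WildGL2.GammaTilde D n m →* (AlgebraicClosure ℚ_[ℓ])ˣ)
    (hθt : ∀ t : Eˣ, θt (WildGL2.torusHom D n m t) = θ t)
    (u : F) (hu : 1 ≤ WildGL2.ord F u) :
    FiniteDimensional (AlgebraicClosure ℚ_[ℓ])
        (WildGL2.IsotypicPart
          (WildGL2.cohomologyRep (AlgebraicClosure ℚ_[ℓ]) (WildGL2.rightAction D n m)) θt) ∧
      (WildGL2.ord F u < ((n + d : ℕ) : ℤ) →
        LinearMap.trace _ _ (WildGL2.Xi D n m θt (WildGL2.unipotent D u hu)) = 0) ∧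
      (WildGL2.ord F u = ((n + d : ℕ) : ℤ) →
        LinearMap.trace _ _ (WildGL2.Xi D n m θt (WildGL2.unipotent D u hu)) =
          -(WildGL2.residueCard F : AlgebraicClosure ℚ_[ℓ]) ^ (n + d - 1)) ∧
      (((n + d + 1 : ℕ) : ℤ) ≤ WildGL2.ord F u →
        LinearMap.trace _ _ (WildGL2.Xi D n m θt (WildGL2.unipotent D u hu)) =
          ((WildGL2.residueCard F : AlgebraicClosure ℚ_[ℓ]) - 1) *
            (WildGL2.residueCard F : AlgebraicClosure ℚ_[ℓ]) ^ (n + d - 1)) := by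
  open WildGL2 in
  classical
  have hn1 : 1 ≤ n := by omega
  have hd := D.two_half
  have hd0 := D.d_pos
  refine ⟨D.finiteDimensional_isotypicPart m hn1 θt, fun h => ?_, fun h => ?_, fun h => ?_⟩
  · have hu0 : u ≠ 0 := by
      rintro rfl
      rw [ord_zero] at h
      exact not_top_lt h
    obtain ⟨k, hk⟩ := exists_ord hu0
    rw [hk, WithTop.coe_lt_coe] at h
    -- Either no orbit is preserved, or all are and `ψ` is non-trivial on `𝔭_F^(n+d-k) ⊆ 𝔭_F`, so
    -- that the sums over `O_F` and over `𝔭_F` both vanish.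
    by_cases hu' : algebraMap F E u ∈ pPow E (n + d + 1)
    · rw [mem_pPow, D.ord_algebraMap_of hk rfl, WithTop.coe_le_coe] at hu'
      have hw : u / D.Δ ∈ pPow F ((n + 1) / 2 : ℕ) :=
        pPow_mono (by omega) (D.mem_pPow_div_Δ (mem_pPow_of_ord hk))
      obtain ⟨ψ, hψ⟩ := D.exists_addChar hm hn1 hθ hθt hw
      obtain ⟨b, hb, hb'⟩ := D.addChar_ne_one hm hn1 hθ hθt hψ (i := n + d - k)
        (by push_cast at h; omega) (by rw [hk, sub_sub_cancel])
      have hb1 := pPow_mono (i := 1) (by push_cast at h; omega) hb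
      rw [D.trace_eq_of_mem hn1 hu hw ψ hψ, if_neg fun H => hb' (H _),
        if_neg fun H => hb' (H _ ((mk_mem_pQuotOne (by omega) b).2 hb1)), sub_zero, mul_zero]
    · exact D.trace_eq_zero_of_notMem m hn1 θt hu hu'
  · have hw' := D.mem_pPow_div_Δ (mem_pPow_of_ord h)
    have hw : u / D.Δ ∈ pPow F ((n + 1) / 2 : ℕ) := pPow_mono (by omega) hw'
    obtain ⟨ψ, hψ⟩ := D.exists_addChar hm hn1 hθ hθt hw
    -- Here `ψ` is non-trivial on `O_F` but trivial on `𝔭_F`: only the subtracted sum over `𝔭_F`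
    -- survives, whence the minus sign.
    obtain ⟨b, -, hb'⟩ := D.addChar_ne_one hm hn1 hθ hθt hψ le_rfl (by rw [h]; simp)
    rw [D.trace_eq_of_mem hn1 hu hw ψ hψ, if_neg fun H => hb' (H _), if_pos, zero_sub, mul_neg,
      ← pow_add]
    · congr 2
      omega
    · rintro _ ⟨b, hb, rfl⟩
      exact D.addChar_eq_one hm hn1 hθ hθt hw hψ (i := 1) (pPow_mono (by omega) hw') b hb
  · have hw' := D.mem_pPow_div_Δ (mem_pPow.2 h)
    have hw : u / D.Δ ∈ pPow F ((n + 1) / 2 : ℕ) := pPow_mono (by omega) hw'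
    obtain ⟨ψ, hψ⟩ := D.exists_addChar hm hn1 hθ hθt hw
    -- With `ψ` trivial the sum just counts the unit classes, `q^c - q^(c-1)` for `c = ⌊(n+d+1)/2⌋`.
    have h1 : ∀ x, ψ x = 1 := by
      intro x
      obtain ⟨b, rfl⟩ := QuotientAddGroup.mk_surjective x
      exact D.addChar_eq_one hm hn1 hθ hθt hw hψ (i := 0) (pPow_mono (by omega) hw') b b.2
    rw [D.trace_eq_of_mem hn1 hu hw ψ hψ, if_pos h1, if_pos fun x _ => h1 x, mul_sub, ← pow_add,
      ← pow_add, sub_mul, one_mul, ← pow_succ']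
    congr 2 <;> omega
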